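/- Let $d\ge 2$, let $B^d$ be the unit ball of $\mathbb R^d$, and let $L^2_{rad}(B^d)$ be the space of radial functions in $L^2(B^d;\mathbb C)$. Let $(e_n)_{n\ge1}$ be the $L^2$-normalized radial eigenfunctions of the Dirichlet Laplacian on $B^d$, $-\Delta e_n=z_n^2e_n$ in $B^d$, $e_n=0$ on $\partial B^d$, with $0<z_1<z_2<\cdots$. For $u=\sum_n c_ne_n\in L^2_{rad}(B^d)$ put $$S_\sigma(t)u=\sum_{n\ge1}e^{-itz_n^{2\sigma}}c_ne_n,\qquad \mathbf 1_{\sqrt{-\Delta}\in[N,2N]}u=\sum_{n:\,N\le z_n\le 2N}c_ne_n .$$ **Lemma.** For every $\varepsilon>0$ there is a constant $C=C(d,\varepsilon)>0$ such that, for all $\sigma\in[\frac12,1]$, all real $N_1,N_2>0$ and all $u_1,u_2\in L^2_{rad}(B^d)$ with $\mathbf 1_{\sqrt{-\Delta}\in[N_j,2N_j]}u_j=u_j$ for $j=1,2$, the following hold. 1. If $N_1\ge N_2$, then $$\|S_\sigma(t)u_1\,S_\sigma(t)u_2\|_{L^2_{t,x}((0,1)\times B^d)}\le C\,N_2^{\frac{d-1}2+\varepsilon}\,\|u_1\|_{L^2(B^d)}\|u_2\|_{L^2(B^d)}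 .$$ 2. For every $t\in\mathbb R$, $S_\sigma(t)u_1$ has a weak gradient in $L^2(B^d)$, and (without any assumption on the order of $N_1$ and $N_2$) $$\|\nabla S_\sigma(t)u_1\;S_\sigma(t)u_2\|_{L^2_{t,x}((0,1)\times B^d)}\le C\,N_1N_2^{\frac{d-1}2+\varepsilon}\,\|u_1\|_{L^2(B^d)}\|u_2\|_{L^2(B^d)} .$$ -/

import Mathlib

open MeasureTheory Set
open scoped ENNReal InnerProductSpace ContDiff

noncomputable section

/-- The open unit ball `B^d` of `ℝ^d`. -/
def unitBall (d : ℕ) : Set (EuclideanSpace ℝ (Fin d)) := Metric.ball 0 1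

/-- Lebesgue measure on the unit ball. -/
def ballMeasure (d : ℕ) : Measure (EuclideanSpace ℝ (Fin d)) := volume.restrict (unitBall d)

/-- The complex Hilbert space `L²(B^d)`. -/
abbrev L2Ball (d : ℕ) : Type := Lp ℂ 2 (ballMeasure d)

/-- `u ∈ L²_rad(B^d)`: an `L²` function that depends only on `|x|`. -/
def IsRadialL2 {d : ℕ} (u : L2Ball d) : Prop :=
  ∃ g : ℝ → ℂ, ∀ᵐ x ∂ballMeasure d, u x = g ‖x‖

/-- `f` is a radial solution of `-Δ f = z² f` in `B^d`, `f = 0` on `∂B^d` (the zero function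
is allowed). It is a classical solution: `C²` in the open ball (including the origin) and
continuous up to the boundary. -/
structure IsRadialDirichletSolution (d : ℕ) (z : ℝ) (f : EuclideanSpace ℝ (Fin d) → ℂ) :
    Prop where
  radial : ∀ x ∈ unitBall d, ∀ y ∈ unitBall d, ‖x‖ = ‖y‖ → f x = f y
  continuousOn : ContinuousOn f (Metric.closedBall 0 1)
  contDiffOn : ContDiffOn ℝ 2 f (unitBall d)
  helmholtz : ∀ x ∈ unitBall d, -Laplacian.laplacian f x = ((z ^ 2 : ℝ) : ℂ) * f x
  boundary : ∀ x ∈ Metric.sphere (0 : EuclideanSpace ℝ (Fin d)) 1, f x = 0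

theorem isOpen_unitBall (d : ℕ) : IsOpen (unitBall d) := Metric.isOpen_ball

theorem IsRadialDirichletSolution.zero (d : ℕ) (z : ℝ) :
    IsRadialDirichletSolution d z (0 : EuclideanSpace ℝ (Fin d) → ℂ) where
  radial := by simp
  continuousOn := continuousOn_const
  contDiffOn := contDiffOn_const
  helmholtz := by
    intro x _
    have h : (0 : EuclideanSpace ℝ (Fin d) → ℂ) = fun _ => (0 : ℂ) := rfl
    rw [h, InnerProductSpace.laplacian_const]
    simp
  boundary := by simp

theorem IsRadialDirichletSolution.add {d : ℕ} {z : ℝ} {f g : EuclideanSpace ℝ (Fin d) → ℂ}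
    (hf : IsRadialDirichletSolution d z f) (hg : IsRadialDirichletSolution d z g) :
    IsRadialDirichletSolution d z (f + g) where
  radial x hx y hy h := by
    simp only [Pi.add_apply]
    rw [hf.radial x hx y hy h, hg.radial x hx y hy h]
  continuousOn := hf.continuousOn.add hg.continuousOn
  contDiffOn := hf.contDiffOn.add hg.contDiffOn
  helmholtz x hx := by
    have hn := (isOpen_unitBall d).mem_nhds hx
    rw [ContDiffAt.laplacian_add (hf.contDiffOn.contDiffAt hn) (hg.contDiffOn.contDiffAt hn),
      neg_add, hf.helmholtz x hx, hg.helmholtz x hx, Pi.add_apply, mul_add]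
  boundary x hx := by
    simp [hf.boundary x hx, hg.boundary x hx]

theorem IsRadialDirichletSolution.smul {d : ℕ} {z : ℝ} {f : EuclideanSpace ℝ (Fin d) → ℂ}
    (c : ℂ) (hf : IsRadialDirichletSolution d z f) :
    IsRadialDirichletSolution d z (c • f) where
  radial x hx y hy h := by
    simp only [Pi.smul_apply]
    rw [hf.radial x hx y hy h]
  continuousOn := hf.continuousOn.const_smul c
  contDiffOn := contDiffOn_const.smul hf.contDiffOn
  helmholtz x hx := by
    have hn := (isOpen_unitBall d).mem_nhds hx
    rw [InnerProductSpace.laplacian_smul c (hf.contDiffOn.contDiffAt hn), ← smul_neg,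
      hf.helmholtz x hx, Pi.smul_apply]
    simp only [smul_eq_mul]
    ring
  boundary x hx := by
    simp [hf.boundary x hx]

/-- The eigenspace of the radial Dirichlet Laplacian `-Δ` on `B^d` for the eigenvalue `z²`, as a
subspace of `L²(B^d)`. -/
def radialEigenspace (d : ℕ) (z : ℝ) : Submodule ℂ (L2Ball d) where
  carrier := {u | ∃ f, IsRadialDirichletSolution d z f ∧ u =ᵐ[ballMeasure d] f}
  zero_mem' := ⟨0, .zero d z, Lp.coeFn_zero _ _ _⟩
  add_mem' := by
    rintro u v ⟨f, hf, huf⟩ ⟨g, hg, hvg⟩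
    exact ⟨f + g, hf.add hg, (Lp.coeFn_add u v).trans (huf.add hvg)⟩
  smul_mem' := by
    rintro c u ⟨f, hf, huf⟩
    exact ⟨c • f, hf.smul c, (Lp.coeFn_smul c u).trans (huf.const_smul c)⟩

/-- The frequencies `z_1 < z_2 < …`: the `z > 0` for which `z²` is an eigenvalue of the radial
Dirichlet Laplacian on `B^d`. -/
def radialFrequencies (d : ℕ) : Set ℝ := {z | 0 < z ∧ radialEigenspace d z ≠ ⊥}

/-- The orthogonal projection of `L²(B^d)` onto the eigenspace of frequency `z`. For `z = z_n`
this is `u ↦ ⟨u, e_n⟩ e_n`, with `e_n` the normalized eigenfunction. (The eigenspace is at most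
one-dimensional, hence closed; its closure is written only so that the projection exists by
completeness.) -/
def eigenProj (d : ℕ) (z : ℝ) : L2Ball d →L[ℂ] L2Ball d :=
  (radialEigenspace d z).topologicalClosure.starProjection

/-- Functional calculus `m(√-Δ) u = ∑_n m(z_n) ⟨u, e_n⟩ e_n` of the radial Dirichlet Laplacian
(the sum converges in `L²(B^d)`, for bounded `m`). -/
def spectralMultiplier {d : ℕ} (m : ℝ → ℂ) (u : L2Ball d) : L2Ball d :=
  ∑' z : radialFrequencies d, m z • eigenProj d z u

/-- The linear fractional Schrödinger flow `S_σ(t) = exp(-i t (-Δ)^σ)`. -/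
def schrodingerFlow {d : ℕ} (σ t : ℝ) (u : L2Ball d) : L2Ball d :=
  spectralMultiplier (fun z => Complex.exp (-Complex.I * ((t * z ^ (2 * σ) : ℝ) : ℂ))) u

/-- Frequency localization at `N`: `1_{√-Δ ∈ [N, 2N]} u = u`. -/
def FrequencyLocalized {d : ℕ} (N : ℝ) (u : L2Ball d) : Prop :=
  spectralMultiplier (indicator (Icc N (2 * N)) 1) u = u

/-- The vector field `G ∈ L²(B^d)` is the weak gradient of `u ∈ L²(B^d)` on the open ball. -/
def HasWeakGradient {d : ℕ} (u : L2Ball d) (G : Lp (EuclideanSpace ℂ (Fin d)) 2 (ballMeasure d)) :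
    Prop :=
  ∀ φ : EuclideanSpace ℝ (Fin d) → ℝ, ContDiff ℝ ∞ φ → HasCompactSupport φ →
    tsupport φ ⊆ unitBall d → ∀ i : Fin d,
      ∫ x in unitBall d, ((fderiv ℝ φ x (EuclideanSpace.single i 1) : ℝ) : ℂ) * u x =
        -∫ x in unitBall d, ((φ x : ℝ) : ℂ) * G x i

/-- The norm `‖F‖_{L²_{t,x}((0,1) × B^d)} = (∫_0^1 ∫_{B^d} |F(t,x)|² dx dt)^{1/2}`, as an extended
nonnegative number. -/
def spacetimeL2Norm {d : ℕ} {V : Type*} [NormedAddCommGroup V]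
    (F : ℝ → EuclideanSpace ℝ (Fin d) → V) : ℝ≥0∞ :=
  (∫⁻ t in Ioo (0 : ℝ) 1, ∫⁻ x in unitBall d, ‖F t x‖ₑ ^ 2) ^ (1 / 2 : ℝ)

end

/-! The estimate is proved pointwise in `x`: integrate in time first, using only that the
frequencies are separated, then in space, using only the size of the eigenfunctions. No Bessel
asymptotics enter; everything about eigenfunctions comes from energy arguments for the radial
equation of a profile `F` with derivative `p`.

Size. Put `a = (d - 1) / 2`, `v = r ^ a F` and `M = ∫ r ^ (d - 1) F ^ 2`. Then `v'' + (z² - (a² - a)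
/ r²) v = 0`, so the energy `v'² + z² v²` changes by at most a constant factor on `[1 / z, 1]`.
Pohozaev's identity (`deriv_one_sq`) evaluates it at `r = 1` as `2 z² M`. On `[0, 1 / z]` the
undamped energy `p² + z² F²` takes over. This gives `r ^ (d - 1) F² ≲ M`, `F² ≲ z ^ (d - 1) M` and
`r ^ (d - 1) p² ≲ z² M`.

Gaps. If `z < w` are frequencies, scaling and uniqueness at the origin show that the profile of `w`
vanishes at `z / w` as well as at `1`. Near-conservation of the Liouville energy bounds the distance
of two such zeros below by a constant over `w` (`exp_le_sub`), hence `w - z ≥ c`. All frequencies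
exceed `1`, so for `2σ ≥ 1` the phases `z ^ (2σ)` are separated by the same `c`.

Time. Replacing `1_{(0,1)}` by `e ^ (-|t|)`, whose Fourier transform is `2 / (1 + ξ²)`, and applying
Schur's test to the phases `w ^ (2σ) + z ^ (2σ)` bounds the time integral of the product at fixed
`x` by `#T₂ · ∑ |f_w(x)|² · ∑ |a_z(x)|²`, with `#T₂ ≲ N₂` by the gaps. Here `a_z` is an
eigenfunction or its gradient (`lintegral_norm_sum_smul_sum_sq_le`).

Space. The factor `|a_z|²` costs `|x| ^ (-(d - 1))`, times `N₁²` for gradients. Interpolating the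
two bounds on `f_w` gives `|f_w|² / |x| ^ (d - 1) ≲ w ^ (d - 2 + s) |x| ^ (s - d)`, integrable for
`s > 0`. The total is `N₂ · N₂ ^ (d - 2 + 2ε)`, the square of the claimed power. -/

/-! ### The radial equation up to the boundary. -/

/-- `F` solves `F'' + (d - 1) / r F' + z² F = 0` on `(0, 1)`, with derivative `p`, and is regular
at the origin. -/
structure IsRadialProfile (d : ℕ) (z : ℝ) {V : Type*} [NormedAddCommGroup V] [NormedSpace ℝ V]
    (F p : ℝ → V) : Prop where
  continuousOn : ContinuousOn F (Icc 0 1)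
  continuousOn_deriv : ContinuousOn p (Icc 0 1)
  deriv_zero : p 0 = 0
  hasDerivAt : ∀ r ∈ Ioo (0 : ℝ) 1, HasDerivAt F (p r) r
  hasDerivAt_deriv : ∀ r ∈ Ioo (0 : ℝ) 1,
    HasDerivAt p (-(((d : ℝ) - 1) / r) • p r - z ^ 2 • F r) r

namespace IsRadialProfile

variable {d : ℕ} {z : ℝ} {V W : Type*} [NormedAddCommGroup V] [NormedSpace ℝ V]
  [NormedAddCommGroup W] [NormedSpace ℝ W]

theorem map (L : V →L[ℝ] W) {F p : ℝ → V} (h : IsRadialProfile d z F p) :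
    IsRadialProfile d z (fun r => L (F r)) (fun r => L (p r)) where
  continuousOn := L.continuous.comp_continuousOn h.continuousOn
  continuousOn_deriv := L.continuous.comp_continuousOn h.continuousOn_deriv
  deriv_zero := by simp [h.deriv_zero]
  hasDerivAt r hr := L.hasFDerivAt.comp_hasDerivAt r (h.hasDerivAt r hr)
  hasDerivAt_deriv r hr := by
    have := L.hasFDerivAt.comp_hasDerivAt r (h.hasDerivAt_deriv r hr)
    simp only [map_sub, map_smul] at this
    exact this

end IsRadialProfile

/-- A derivative satisfying the radial equation on `[0, 1)` extends continuously to `1`. -/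
theorem exists_isRadialProfile_extension {d : ℕ} {z : ℝ} {F q : ℝ → ℂ} (hd : 1 ≤ d)
    (hF : ContinuousOn F (Icc 0 1)) (hq : ContinuousOn q (Ico 0 1)) (hq0 : q 0 = 0)
    (hFq : ∀ r ∈ Ioo (0 : ℝ) 1, HasDerivAt F (q r) r)
    (hqq : ∀ r ∈ Ioo (0 : ℝ) 1,
      HasDerivAt q (-(((d : ℝ) - 1) / r) • q r - z ^ 2 • F r) r) :
    ∃ p, IsRadialProfile d z F p ∧ ∀ r < 1, p r = q r := by
  set g : ℝ → ℂ := fun r => (-(z ^ 2 * r ^ (d - 1))) • F r with hg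
  have hgc : ContinuousOn g (Icc 0 1) := by
    exact ContinuousOn.fun_smul (by fun_prop) hF
  set Q : ℝ → ℂ := fun r => ∫ s in (0 : ℝ)..r, g s with hQ
  have hgi : IntervalIntegrable g volume 0 1 := hgc.intervalIntegrable_of_Icc zero_le_one
  have hQc : ContinuousOn Q (Icc 0 1) := by
    have := intervalIntegral.continuousOn_primitive_interval' hgi (left_mem_uIcc)
    rwa [uIcc_of_le zero_le_one] at this
  -- In divergence form `(r ^ (d - 1) q)' = -z² r ^ (d - 1) F` the right side is continuous up to
  -- `1`, so its primitive `Q` supplies the missing boundary value. The term at `0` is kept because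
  -- `0 ^ (d - 1) = 1` when `d = 1`; it dies by `hq0`.
  have key : ∀ r ∈ Ioo (0 : ℝ) 1, r ^ (d - 1) • q r = Q r + (0 : ℝ) ^ (d - 1) • q 0 := by
    intro r hr
    have hsub : Icc (0 : ℝ) r ⊆ Icc 0 1 := Icc_subset_Icc le_rfl hr.2.le
    have := intervalIntegral.integral_eq_sub_of_hasDerivAt_of_le (f := fun s => s ^ (d - 1) • q s)
      (f' := g) hr.1.le ?_ ?_ ?_
    · simp only [hQ, this]; abel
    · exact ContinuousOn.fun_smul (by fun_prop)
        (hq.mono fun x hx => ⟨hx.1, hx.2.trans_lt hr.2⟩)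
    · intro s hs
      have hs1 : s ∈ Ioo (0 : ℝ) 1 := ⟨hs.1, hs.2.trans hr.2⟩
      have h1 := (hasDerivAt_pow (d - 1) s).fun_smul (hqq s hs1)
      convert h1 using 1
      have hs0 : s ≠ 0 := hs.1.ne'
      obtain ⟨n, rfl⟩ : ∃ n, d = n + 1 := ⟨d - 1, by omega⟩
      simp only [hg, Nat.add_sub_cancel, Complex.real_smul]
      push_cast
      have hs0' : (s : ℂ) ≠ 0 := by exact_mod_cast hs0
      rcases n with _ | n
      · simp
      · simp only [Nat.add_sub_cancel]
        field_simp
        push_cast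
        ring
    · exact (hgc.mono hsub).intervalIntegrable_of_Icc hr.1.le
  simp only [hq0, smul_zero, add_zero] at key
  set p : ℝ → ℂ := fun r => if r < 1 then q r else Q 1 with hp
  have hpq : ∀ r < 1, p r = q r := fun r hr => by simp [hp, hr]
  have hev : ∀ r ∈ Ioo (0 : ℝ) 1, p =ᶠ[nhds r] q := fun r hr =>
    Filter.eventually_of_mem (Iio_mem_nhds hr.2) hpq
  refine ⟨p, ⟨hF, ?_, ?_, ?_, ?_⟩, hpq⟩
  · intro r hr
    rcases hr.2.lt_or_eq with h1 | h1
    · have : ContinuousWithinAt q (Icc 0 1) r := by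
        refine (hq r ⟨hr.1, h1⟩).mono_of_mem_nhdsWithin ?_
        filter_upwards [self_mem_nhdsWithin, mem_nhdsWithin_of_mem_nhds (Iio_mem_nhds h1)] with s a b
        exact ⟨a.1, b⟩
      exact this.congr_of_eventuallyEq
        (mem_nhdsWithin_of_mem_nhds (Filter.eventually_of_mem (Iio_mem_nhds h1) hpq)) (hpq r h1)
    · subst h1
      have : ContinuousWithinAt (fun r : ℝ => (r ^ (d - 1))⁻¹ • Q r) (Icc 0 1) 1 :=
        ContinuousWithinAt.fun_smul (ContinuousAt.continuousWithinAt
          (ContinuousAt.inv₀ (f := fun r : ℝ => r ^ (d - 1)) (by fun_prop) (by simp))) (hQc 1 hr)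
      refine this.congr_of_eventuallyEq ?_ (by simp [hp])
      filter_upwards [self_mem_nhdsWithin,
        mem_nhdsWithin_of_mem_nhds (Ioi_mem_nhds (zero_lt_one (α := ℝ)))] with s a b
      rcases a.2.lt_or_eq with h2 | h2
      · rw [hpq s h2, ← key s ⟨b, h2⟩, inv_smul_smul₀ (pow_pos b _).ne']
      · simp [hp, h2]
  · rw [hpq 0 zero_lt_one, hq0]
  · intro r hr
    rw [hpq r hr.2]
    exact hFq r hr
  · intro r hr
    rw [hpq r hr.2]
    exact (hqq r hr).congr_of_eventuallyEq (hev r hr)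

/-! ### Radial Dirichlet solutions have radial profiles. -/

theorem hasFDerivAt_norm_of_ne_zero {E : Type*} [NormedAddCommGroup E] [InnerProductSpace ℝ E]
    {x : E} (hx : x ≠ 0) : HasFDerivAt (fun y : E => ‖y‖) (‖x‖⁻¹ • innerSL ℝ x) x := by
  have h := (hasStrictFDerivAt_norm_sq x).hasFDerivAt.sqrt (by positivity)
  simp only [Real.sqrt_sq (norm_nonneg _)] at h
  convert h using 1
  rw [two_smul, ← two_smul ℝ, smul_smul]
  congr 1
  field_simp

theorem HasFDerivAt.hasDerivAt_comp_apply {E G : Type*} [NormedAddCommGroup E] [NormedSpace ℝ E]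
    [NormedAddCommGroup G] [NormedSpace ℝ G] {T : E → E →L[ℝ] G} {T' : E →L[ℝ] E →L[ℝ] G}
    {y : ℝ → E} {v : E} {s : ℝ} (hT : HasFDerivAt T T' (y s)) (hy : HasDerivAt y v s) (w : E) :
    HasDerivAt (fun t => T (y t) w) (T' v w) s :=
  (ContinuousLinearMap.apply ℝ G w).hasFDerivAt.comp_hasDerivAt s (hT.comp_hasDerivAt s hy)

namespace IsRadialDirichletSolution

variable {d : ℕ} {z : ℝ} {f : EuclideanSpace ℝ (Fin d) → ℂ}

theorem apply_eq (hf : IsRadialDirichletSolution d z f) (i : Fin d) {x : EuclideanSpace ℝ (Fin d)}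
    (hx : x ∈ unitBall d) : f x = f (‖x‖ • EuclideanSpace.single i (1 : ℝ)) := by
  have hn : ‖(‖x‖ • EuclideanSpace.single i (1 : ℝ) : EuclideanSpace ℝ (Fin d))‖ = ‖x‖ := by
    simp [norm_smul]
  refine hf.radial x hx _ ?_ hn.symm
  simp only [unitBall, mem_ball_zero_iff] at hx ⊢
  rwa [hn]

theorem differentiableAt (hf : IsRadialDirichletSolution d z f) {x : EuclideanSpace ℝ (Fin d)}
    (hx : x ∈ unitBall d) : DifferentiableAt ℝ f x :=
  (hf.contDiffOn.contDiffAt ((isOpen_unitBall d).mem_nhds hx)).differentiableAt (by norm_num)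

theorem differentiableAt_fderiv (hf : IsRadialDirichletSolution d z f)
    {x : EuclideanSpace ℝ (Fin d)} (hx : x ∈ unitBall d) : DifferentiableAt ℝ (fderiv ℝ f) x :=
  ((hf.contDiffOn.contDiffAt ((isOpen_unitBall d).mem_nhds hx)).fderiv_right
    (m := 1) (by norm_num)).differentiableAt (by norm_num)

/-- A radial function is even near the origin, so its derivative there equals its own negative. -/
theorem fderiv_zero (hf : IsRadialDirichletSolution d z f) : fderiv ℝ f 0 = 0 := by
  have h0 : (0 : EuclideanSpace ℝ (Fin d)) ∈ unitBall d := by simp [unitBall]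
  have h1 := (hf.differentiableAt h0).hasFDerivAt
  have hneg : HasFDerivAt (fun y : EuclideanSpace ℝ (Fin d) => -y)
      (-ContinuousLinearMap.id ℝ _) 0 := (hasFDerivAt_id 0).neg
  have h2 : HasFDerivAt (fun y => f (-y)) ((fderiv ℝ f 0).comp (-ContinuousLinearMap.id ℝ _)) 0 :=
    HasFDerivAt.comp (g := f) (0 : EuclideanSpace ℝ (Fin d)) (by simpa using h1) hneg
  have h3 : HasFDerivAt f ((fderiv ℝ f 0).comp (-ContinuousLinearMap.id ℝ _)) 0 := by
    refine h2.congr_of_eventuallyEq ?_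
    filter_upwards [(isOpen_unitBall d).mem_nhds h0] with y hy
    refine hf.radial y hy (-y) ?_ (norm_neg y).symm
    simpa [unitBall] using hy
  have h4 := h1.unique h3
  ext v
  have h5 := DFunLike.congr_fun h4 v
  simp only [ContinuousLinearMap.comp_apply, neg_apply,
    ContinuousLinearMap.id_apply, map_neg] at h5
  simpa using self_eq_neg.mp h5

/-- Chain rule for `y ↦ f (‖y‖ e_i)`. The origin is covered by `fderiv_zero` and division by zero.
-/
theorem fderiv_apply (hf : IsRadialDirichletSolution d z f) (i : Fin d)
    {x : EuclideanSpace ℝ (Fin d)} (hx : x ∈ unitBall d) (v : EuclideanSpace ℝ (Fin d)) :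
    fderiv ℝ f x v = (⟪x, v⟫_ℝ / ‖x‖) •
      fderiv ℝ f (‖x‖ • EuclideanSpace.single i 1) (EuclideanSpace.single i 1) := by
  by_cases hx0 : x = 0
  · simp [hx0, hf.fderiv_zero]
  have hx' : ‖x‖ • EuclideanSpace.single i (1 : ℝ) ∈ unitBall d := by
    simpa [unitBall, norm_smul] using hx
  have h1 : HasFDerivAt (fun y => f (‖y‖ • EuclideanSpace.single i (1 : ℝ)))
      ((fderiv ℝ f (‖x‖ • EuclideanSpace.single i 1)).comp
        ((‖x‖⁻¹ • innerSL ℝ x).smulRight (EuclideanSpace.single i (1 : ℝ)))) x :=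
    HasFDerivAt.comp x (hf.differentiableAt hx').hasFDerivAt
      ((hasFDerivAt_norm_of_ne_zero hx0).smul_const _)
  have h2 : HasFDerivAt f _ x := h1.congr_of_eventuallyEq (by
    filter_upwards [(isOpen_unitBall d).mem_nhds hx] with y hy using hf.apply_eq i hy)
  rw [h2.fderiv]
  simp [div_eq_inv_mul]

theorem laplacian_eq_sum {x : EuclideanSpace ℝ (Fin d)} :
    Laplacian.laplacian f x = ∑ j, fderiv ℝ (fderiv ℝ f) x (EuclideanSpace.single j 1)
      (EuclideanSpace.single j 1) := by
  rw [InnerProductSpace.laplacian_eq_iteratedFDeriv_orthonormalBasis f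
    (EuclideanSpace.basisFun (Fin d) ℝ)]
  simp [iteratedFDeriv_two_apply]

theorem hasDerivAt_line_fderiv (hf : IsRadialDirichletSolution d z f)
    {x : EuclideanSpace ℝ (Fin d)} (hx : x ∈ unitBall d) (v : EuclideanSpace ℝ (Fin d)) :
    HasDerivAt (fun s : ℝ => fderiv ℝ f (x + s • v) v) (fderiv ℝ (fderiv ℝ f) x v v) 0 := by
  have h1 : HasDerivAt (fun s : ℝ => x + s • v) v 0 := by
    simpa using ((hasDerivAt_id (0 : ℝ)).smul_const v).const_add x
  have h2 : HasFDerivAt (fderiv ℝ f) (fderiv ℝ (fderiv ℝ f) x) (x + (0 : ℝ) • v) := by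
    rw [zero_smul, add_zero]
    exact (hf.differentiableAt_fderiv hx).hasFDerivAt
  exact HasFDerivAt.hasDerivAt_comp_apply (y := fun s : ℝ => x + s • v) h2 h1 v

/-- Along the tangent line `r e + s v` the first derivative in direction `v` is `s k(s)`, by
`fderiv_apply`. Continuity of `k` at `0` suffices for `s k(s)` to have derivative `k(0)` there, so
`k` need not be differentiated. The `d - 1` tangential directions thus produce the first-order term
of the radial Laplacian. -/
theorem fderiv_fderiv_tangential (hf : IsRadialDirichletSolution d z f) {i j : Fin d}
    (hji : j ≠ i) {r : ℝ} (hr : r ∈ Ioo (0 : ℝ) 1) :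
    fderiv ℝ (fderiv ℝ f) (r • EuclideanSpace.single i 1) (EuclideanSpace.single j 1)
      (EuclideanSpace.single j 1) =
    r⁻¹ • fderiv ℝ f (r • EuclideanSpace.single i 1) (EuclideanSpace.single i 1) := by
  set v : EuclideanSpace ℝ (Fin d) := EuclideanSpace.single j 1 with hv
  set e : EuclideanSpace ℝ (Fin d) := EuclideanSpace.single i 1 with he
  have hn : ‖r • e‖ = r := by simp [norm_smul, he, abs_of_pos hr.1]
  have hxm : r • e ∈ unitBall d := by
    rw [unitBall, mem_ball_zero_iff, hn]; exact hr.2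
  have hinner : ⟪e, v⟫_ℝ = 0 := by
    simpa only [EuclideanSpace.basisFun_apply] using
      (EuclideanSpace.basisFun (Fin d) ℝ).orthonormal.2 hji.symm
  have hvv : ⟪v, v⟫_ℝ = 1 := by simp [hv]
  have hyc : ContinuousAt (fun s : ℝ => r • e + s • v) 0 := by fun_prop
  have hn0 : ‖r • e + (0 : ℝ) • v‖ = r := by rw [zero_smul, add_zero, hn]
  have hk : ContinuousAt (fun s : ℝ => ‖r • e + s • v‖⁻¹ •
      fderiv ℝ f (‖r • e + s • v‖ • e) e) 0 := by
    refine ContinuousAt.fun_smul (hyc.norm.inv₀ (by rw [hn0]; exact hr.1.ne')) ?_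
    refine ContinuousAt.clm_apply ?_ continuousAt_const
    refine ContinuousAt.comp (g := fderiv ℝ f) (f := fun s : ℝ => ‖r • e + s • v‖ • e) ?_
      (hyc.norm.fun_smul continuousAt_const)
    simp only [hn0]
    exact (hf.differentiableAt_fderiv hxm).continuousAt
  have h1 : HasDerivAt (fun s : ℝ => s • (‖r • e + s • v‖⁻¹ •
      fderiv ℝ f (‖r • e + s • v‖ • e) e)) (r⁻¹ • fderiv ℝ f (r • e) e) 0 := by
    rw [hasDerivAt_iff_tendsto_slope_zero]
    have h2 : Filter.Tendsto _ (nhdsWithin (0 : ℝ) {0}ᶜ) _ := hk.tendsto.mono_left inf_le_left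
    rw [hn0] at h2
    refine h2.congr' ?_
    filter_upwards [self_mem_nhdsWithin] with t ht
    rw [zero_smul, sub_zero, zero_add, inv_smul_smul₀ (show t ≠ 0 from ht)]
  refine (hf.hasDerivAt_line_fderiv hxm v).unique (h1.congr_of_eventuallyEq ?_)
  have hnb : ∀ᶠ s : ℝ in nhds 0, r • e + s • v ∈ unitBall d :=
    hyc.eventually ((isOpen_unitBall d).mem_nhds (by simpa using hxm))
  filter_upwards [hnb] with s hs
  rw [hf.fderiv_apply i hs v, inner_add_left, inner_smul_left, inner_smul_left, hinner, hvv,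
    smul_smul]
  simp [div_eq_mul_inv, he]

theorem hasDerivAt_fderiv_radial (hd : 1 ≤ d) (hf : IsRadialDirichletSolution d z f) (i : Fin d)
    {r : ℝ} (hr : r ∈ Ioo (0 : ℝ) 1) :
    HasDerivAt (fun r : ℝ => fderiv ℝ f (r • EuclideanSpace.single i 1)
        (EuclideanSpace.single i 1))
      (-(((d : ℝ) - 1) / r) • fderiv ℝ f (r • EuclideanSpace.single i 1)
        (EuclideanSpace.single i 1) - z ^ 2 • f (r • EuclideanSpace.single i 1)) r := by
  set e : EuclideanSpace ℝ (Fin d) := EuclideanSpace.single i 1 with he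
  have hn : ‖r • e‖ = r := by simp [norm_smul, he, abs_of_pos hr.1]
  have hxm : r • e ∈ unitBall d := by
    rw [unitBall, mem_ball_zero_iff, hn]; exact hr.2
  have hline : HasDerivAt (fun s : ℝ => s • e) e r := by
    simpa using (hasDerivAt_id r).smul_const e
  have hD : HasDerivAt (fun r : ℝ => fderiv ℝ f (r • e) e)
      (fderiv ℝ (fderiv ℝ f) (r • e) e e) r :=
    HasFDerivAt.hasDerivAt_comp_apply (y := fun s : ℝ => s • e)
      (hf.differentiableAt_fderiv hxm).hasFDerivAt hline e
  have hlap := hf.helmholtz _ hxm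
  rw [laplacian_eq_sum, ← Finset.add_sum_erase _ _ (Finset.mem_univ i),
    Finset.sum_congr rfl (fun j hj => hf.fderiv_fderiv_tangential (Finset.ne_of_mem_erase hj) hr),
    Finset.sum_const, Finset.card_erase_of_mem (Finset.mem_univ i), Finset.card_univ,
    Fintype.card_fin, ← he] at hlap
  have h3 : fderiv ℝ (fderiv ℝ f) (r • e) e e = -(((z ^ 2 : ℝ) : ℂ) * f (r • e)) -
    (d - 1) • r⁻¹ • fderiv ℝ f (r • e) e := by
    rw [← hlap]; ring
  convert hD using 1
  rw [h3, ← Nat.cast_smul_eq_nsmul ℝ, Nat.cast_sub hd]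
  simp only [Complex.real_smul]
  push_cast
  ring

theorem exists_isRadialProfile (hd : 1 ≤ d) (hf : IsRadialDirichletSolution d z f) :
    ∃ F p, IsRadialProfile d z F p ∧ F 1 = 0 ∧ (∀ x ∈ unitBall d, f x = F ‖x‖) ∧
      ∀ x ∈ unitBall d, ∀ v, fderiv ℝ f x v = (⟪x, v⟫_ℝ / ‖x‖) • p ‖x‖ := by
  set i : Fin d := ⟨0, hd⟩
  set e : EuclideanSpace ℝ (Fin d) := EuclideanSpace.single i 1 with he
  have hmem : ∀ r ∈ Ico (0 : ℝ) 1, r • e ∈ unitBall d := fun r hr => by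
    simpa [unitBall, norm_smul, he, abs_of_nonneg hr.1] using hr.2
  have hline : ∀ r : ℝ, HasDerivAt (fun s : ℝ => s • e) e r := fun r => by
    simpa using (hasDerivAt_id r).smul_const e
  have c1 : ContinuousOn (fun r : ℝ => f (r • e)) (Icc 0 1) := by
    refine hf.continuousOn.comp (by fun_prop) fun r hr => ?_
    simpa [he, norm_smul, abs_of_nonneg hr.1] using hr.2
  have c2 : ContinuousOn (fun r : ℝ => fderiv ℝ f (r • e) e) (Ico 0 1) := by
    intro r hr
    have h1 : ContinuousAt (fun r : ℝ => fderiv ℝ f (r • e)) r :=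
      ContinuousAt.comp (hf.differentiableAt_fderiv (hmem r hr)).continuousAt
        (hline r).continuousAt
    exact (h1.clm_apply continuousAt_const).continuousWithinAt
  have c3 : fderiv ℝ f ((0 : ℝ) • e) e = 0 := by simp [hf.fderiv_zero]
  have c4 : ∀ r ∈ Ioo (0 : ℝ) 1,
      HasDerivAt (fun r : ℝ => f (r • e)) (fderiv ℝ f (r • e) e) r := fun r hr =>
    (hf.differentiableAt (hmem r ⟨hr.1.le, hr.2⟩)).hasFDerivAt.comp_hasDerivAt r (hline r)
  obtain ⟨p, hp, hpq⟩ := exists_isRadialProfile_extension hd c1 c2 c3 c4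
    (fun r hr => hf.hasDerivAt_fderiv_radial hd i hr)
  refine ⟨_, p, hp, hf.boundary _ (by simp [he]), fun x hx => hf.apply_eq i hx, fun x hx v => ?_⟩
  rw [hpq _ (by simpa [unitBall] using hx)]
  exact hf.fderiv_apply i hx v

end IsRadialDirichletSolution

/-! ### Energy estimates near the origin and Pohozaev's identity. -/

namespace IsRadialProfile

variable {d : ℕ} {z w : ℝ} {F p G q : ℝ → ℝ}

theorem hasDerivAt_pow_mul_deriv {F p : ℝ → ℂ} (hd : 1 ≤ d) (h : IsRadialProfile d z F p) {r : ℝ}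
    (hr : r ∈ Ioo (0 : ℝ) 1) :
    HasDerivAt (fun s : ℝ => (s : ℂ) ^ (d - 1) * p s) (-(z ^ 2 * (r : ℂ) ^ (d - 1) * F r)) r := by
  have hpow : HasDerivAt (fun s : ℝ => (s : ℂ) ^ (d - 1))
      (((d - 1 : ℕ) : ℂ) * (r : ℂ) ^ (d - 1 - 1)) r := by
    simpa using (hasDerivAt_pow (d - 1) (r : ℂ)).comp_ofReal
  refine HasDerivAt.congr_deriv (hpow.fun_mul (h.hasDerivAt_deriv r hr)) ?_
  symm
  have hs0 : (r : ℂ) ≠ 0 := by exact_mod_cast hr.1.ne'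
  obtain ⟨n, rfl⟩ : ∃ n, d = n + 1 := ⟨d - 1, by omega⟩
  simp only [Nat.add_sub_cancel, Complex.real_smul]
  push_cast
  rcases n with _ | n
  · simp
  · simp only [Nat.add_sub_cancel]
    field_simp
    push_cast
    ring

theorem hasDerivAt_pow_mul_deriv_real (hd : 1 ≤ d) (h : IsRadialProfile d z F p) {r : ℝ}
    (hr : r ∈ Ioo (0 : ℝ) 1) :
    HasDerivAt (fun s : ℝ => s ^ (d - 1) * p s) (-(z ^ 2 * r ^ (d - 1) * F r)) r := by
  refine HasDerivAt.congr_deriv ((hasDerivAt_pow (d - 1) r).fun_mul (h.hasDerivAt_deriv r hr)) ?_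
  symm
  have hs0 : r ≠ 0 := hr.1.ne'
  obtain ⟨n, rfl⟩ : ∃ n, d = n + 1 := ⟨d - 1, by omega⟩
  simp only [Nat.add_sub_cancel, smul_eq_mul]
  push_cast
  rcases n with _ | n
  · simp
  · simp only [Nat.add_sub_cancel]
    field_simp
    push_cast
    ring

/-- The first-order term is a damping: the derivative of the energy is `-2 (d - 1) / r · p² ≤ 0`. -/
theorem energy_le (hd : 1 ≤ d) (h : IsRadialProfile d z F p) {r : ℝ} (hr : r ∈ Icc (0 : ℝ) 1) :
    p r ^ 2 + z ^ 2 * F r ^ 2 ≤ z ^ 2 * F 0 ^ 2 := by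
  have hderiv : ∀ r ∈ Ioo (0 : ℝ) 1, HasDerivAt (fun s => p s ^ 2 + z ^ 2 * F s ^ 2)
      (-(2 * (((d : ℝ) - 1) / r) * p r ^ 2)) r := by
    intro r hr
    refine HasDerivAt.congr_deriv (((h.hasDerivAt_deriv r hr).fun_pow 2).fun_add
      (((h.hasDerivAt r hr).fun_pow 2).const_mul (z ^ 2))) ?_
    symm
    simp only [smul_eq_mul]
    push_cast
    ring
  have hanti : AntitoneOn (fun s => p s ^ 2 + z ^ 2 * F s ^ 2) (Icc 0 1) := by
    refine antitoneOn_of_hasDerivWithinAt_nonpos (convex_Icc 0 1)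
      ((h.continuousOn_deriv.pow 2).add (continuousOn_const.mul (h.continuousOn.pow 2)))
      (f' := fun r => -(2 * (((d : ℝ) - 1) / r) * p r ^ 2)) ?_ ?_
    · intro x hx
      rw [interior_Icc] at hx
      exact (hderiv x hx).hasDerivWithinAt
    · intro x hx
      rw [interior_Icc] at hx
      have : (1 : ℝ) ≤ d := by exact_mod_cast hd
      have := div_nonneg (sub_nonneg.2 this) hx.1.le
      have := mul_nonneg this (sq_nonneg (p x))
      linarith
  simpa [h.deriv_zero] using hanti (left_mem_Icc.2 zero_le_one) hr hr.1

theorem abs_le (hd : 1 ≤ d) (hz : 0 < z) (h : IsRadialProfile d z F p) {r : ℝ}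
    (hr : r ∈ Icc (0 : ℝ) 1) : |F r| ≤ |F 0| := by
  have := h.energy_le hd hr
  rw [← sq_le_sq]
  have hz2 : 0 < z ^ 2 := by positivity
  nlinarith [sq_nonneg (p r)]

theorem deriv_sq_le (hd : 1 ≤ d) (h : IsRadialProfile d z F p) {r : ℝ}
    (hr : r ∈ Icc (0 : ℝ) 1) : p r ^ 2 ≤ z ^ 2 * F 0 ^ 2 := by
  have := h.energy_le hd hr
  have : 0 ≤ z ^ 2 * F r ^ 2 := by positivity
  linarith

theorem neg (h : IsRadialProfile d z F p) :
    IsRadialProfile d z (fun r => -F r) (fun r => -p r) :=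
  h.map (-ContinuousLinearMap.id ℝ ℝ)

theorem sub_const_mul (h : IsRadialProfile d z F p) (h' : IsRadialProfile d z G q) (c : ℝ) :
    IsRadialProfile d z (fun r => F r - c * G r) (fun r => p r - c * q r) where
  continuousOn := h.continuousOn.sub (continuousOn_const.mul h'.continuousOn)
  continuousOn_deriv := h.continuousOn_deriv.sub (continuousOn_const.mul h'.continuousOn_deriv)
  deriv_zero := by simp [h.deriv_zero, h'.deriv_zero]
  hasDerivAt r hr := (h.hasDerivAt r hr).fun_sub ((h'.hasDerivAt r hr).const_mul c)
  hasDerivAt_deriv r hr := by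
    refine HasDerivAt.congr_deriv ((h.hasDerivAt_deriv r hr).fun_sub ((h'.hasDerivAt_deriv r hr).const_mul c)) ?_
    symm
    simp only [smul_eq_mul]
    ring

/-- Integrate the divergence form using `|F| ≤ |F 0|`. The sharp constant has an extra `1 / d`,
which is not needed. -/
theorem deriv_ge (hd : 1 ≤ d) (hz : 0 < z) (h : IsRadialProfile d z F p) {r : ℝ}
    (hr : r ∈ Icc (0 : ℝ) 1) : -(z ^ 2 * |F 0| * r) ≤ p r := by
  have hmono : MonotoneOn (fun s => s ^ (d - 1) * p s + z ^ 2 * |F 0| * s ^ d) (Icc 0 1) := by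
    refine monotoneOn_of_hasDerivWithinAt_nonneg (convex_Icc 0 1)
      (ContinuousOn.add (ContinuousOn.mul (by fun_prop) h.continuousOn_deriv) (by fun_prop))
      (f' := fun r => -(z ^ 2 * r ^ (d - 1) * F r) + z ^ 2 * |F 0| * (d * r ^ (d - 1))) ?_ ?_
    · intro x hx
      rw [interior_Icc] at hx
      exact ((h.hasDerivAt_pow_mul_deriv_real hd hx).fun_add
        ((hasDerivAt_pow d x).const_mul _)).hasDerivWithinAt
    · intro x hx
      rw [interior_Icc] at hx
      have h1 := h.abs_le hd hz ⟨hx.1.le, hx.2.le⟩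
      have h2 := (_root_.abs_le.1 h1).2
      have h3 : (1 : ℝ) ≤ d := by exact_mod_cast hd
      have h4 : F x ≤ d * |F 0| := by nlinarith [abs_nonneg (F 0)]
      have h5 : 0 ≤ z ^ 2 * x ^ (d - 1) := mul_nonneg (sq_nonneg z) (pow_nonneg hx.1.le _)
      nlinarith [mul_nonneg h5 (sub_nonneg.2 h4)]
  rcases hr.1.eq_or_lt with h0 | h0
  · simp [← h0, h.deriv_zero]
  · have h1 := hmono (left_mem_Icc.2 zero_le_one) hr hr.1
    simp only [h.deriv_zero, mul_zero, zero_add, zero_pow (show d ≠ 0 by omega)] at h1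
    have h2 : r ^ d = r ^ (d - 1) * r := by rw [← pow_succ]; congr; omega
    rw [h2] at h1
    have h3 : 0 < r ^ (d - 1) := pow_pos h0 _
    have h4 : 0 ≤ r ^ (d - 1) * (p r + z ^ 2 * |F 0| * r) := by linarith
    have := nonneg_of_mul_nonneg_right h4 h3
    linarith

theorem apply_ge (hd : 1 ≤ d) (hz : 0 < z) (h : IsRadialProfile d z F p) {r : ℝ}
    (hr : r ∈ Icc (0 : ℝ) 1) : F 0 - z ^ 2 * |F 0| * r ^ 2 / 2 ≤ F r := by
  have hmono : MonotoneOn (fun s => F s + z ^ 2 * |F 0| / 2 * s ^ 2) (Icc 0 1) := by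
    refine monotoneOn_of_hasDerivWithinAt_nonneg (convex_Icc 0 1)
      (ContinuousOn.add h.continuousOn (by fun_prop))
      (f' := fun r => p r + z ^ 2 * |F 0| / 2 * ((2 : ℕ) * r ^ 1)) ?_ ?_
    · intro x hx
      rw [interior_Icc] at hx
      exact ((h.hasDerivAt x hx).fun_add
        ((hasDerivAt_pow 2 x).const_mul _)).hasDerivWithinAt
    · intro x hx
      rw [interior_Icc] at hx
      have := h.deriv_ge hd hz ⟨hx.1.le, hx.2.le⟩
      push_cast
      linarith
  have := hmono (left_mem_Icc.2 zero_le_one) hr hr.1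
  simp only at this
  nlinarith

/-- No oscillation takes place before the scale `1 / z`. This links the value at the origin to the
region where the Liouville energy is controlled, and forces every frequency to exceed `1`. -/
theorem half_abs_le (hd : 1 ≤ d) (hz : 0 < z) (h : IsRadialProfile d z F p) {r : ℝ}
    (hr : r ∈ Icc (0 : ℝ) 1) (hrz : r * z ≤ 1) : |F 0| / 2 ≤ |F r| := by
  have hb : z ^ 2 * |F 0| * r ^ 2 / 2 ≤ |F 0| / 2 := by
    have h1 : (r * z) ^ 2 ≤ 1 := pow_le_one₀ (mul_nonneg hr.1 hz.le) hrz
    nlinarith [abs_nonneg (F 0)]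
  rcases le_total 0 (F 0) with h0 | h0
  · have := h.apply_ge hd hz hr
    rw [abs_of_nonneg h0] at *
    linarith [le_abs_self (F r)]
  · have := h.neg.apply_ge hd hz hr
    rw [abs_neg] at this
    rw [abs_of_nonpos h0] at *
    linarith [neg_le_abs (F r)]

theorem one_lt_frequency (hd : 1 ≤ d) (hz : 0 < z) (h : IsRadialProfile d z F p) (h1 : F 1 = 0)
    (h0 : F 0 ≠ 0) : 1 < z := by
  by_contra hz1
  have := h.half_abs_le hd hz (right_mem_Icc.2 zero_le_one) (by linarith)
  rw [h1, abs_zero] at this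
  linarith [abs_pos.2 h0]

/-- Pohozaev's identity. -/
theorem deriv_one_sq (hd : 1 ≤ d) (h : IsRadialProfile d z F p) (h1 : F 1 = 0) :
    p 1 ^ 2 = 2 * z ^ 2 * ∫ r in (0 : ℝ)..1, r ^ (d - 1) * F r ^ 2 := by
  have hFi : IntervalIntegrable (fun r => 2 * z ^ 2 * (r ^ (d - 1) * F r ^ 2)) volume 0 1 := by
    apply ContinuousOn.intervalIntegrable_of_Icc zero_le_one
    exact continuousOn_const.mul (ContinuousOn.mul (by fun_prop) (h.continuousOn.pow 2))
  -- The multiplier `r ^ d p` yields the first term of the primitive; the correction `(d - 2) r ^ (d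
  -- - 1) p F` cancels the leftover `p²`. At `1` only `p 1 ^ 2` survives.
  have key := intervalIntegral.integral_eq_sub_of_hasDerivAt_of_le (zero_le_one (α := ℝ))
    (f := fun s => s ^ d * (p s ^ 2 + z ^ 2 * F s ^ 2) + ((d : ℝ) - 2) * (s ^ (d - 1) * p s * F s))
    (f' := fun r => 2 * z ^ 2 * (r ^ (d - 1) * F r ^ 2)) ?_ ?_ hFi
  · simp only [intervalIntegral.integral_const_mul, h.deriv_zero, h1,
      zero_pow (show d ≠ 0 by omega)] at key
    rw [key]
    simp
  · refine ContinuousOn.add (ContinuousOn.mul (by fun_prop)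
      ((h.continuousOn_deriv.pow 2).add (continuousOn_const.mul (h.continuousOn.pow 2))))
      (continuousOn_const.mul (ContinuousOn.mul (ContinuousOn.mul (by fun_prop)
        h.continuousOn_deriv) h.continuousOn))
  · intro r hr
    refine HasDerivAt.congr_deriv (((hasDerivAt_pow d r).fun_mul (((h.hasDerivAt_deriv r hr).fun_pow 2).fun_add
      (((h.hasDerivAt r hr).fun_pow 2).const_mul (z ^ 2)))).fun_add
      (((h.hasDerivAt_pow_mul_deriv_real hd hr).fun_mul (h.hasDerivAt r hr)).const_mul
        ((d : ℝ) - 2))) ?_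
    symm
    have h2 : r ^ d = r ^ (d - 1) * r := by rw [← pow_succ]; congr; omega
    have h3 : r ≠ 0 := hr.1.ne'
    simp only [smul_eq_mul, h2]
    field_simp
    push_cast
    ring

/-! ### The Liouville transform and its almost conserved energy. -/

/-- The energy `|v'|² + z² |v|²` of `v = r ^ ((d - 1) / 2) F`. -/
noncomputable def liouvilleEnergy (d : ℕ) (z : ℝ) (F p : ℝ → ℝ) (r : ℝ) : ℝ :=
  r ^ (d - 1) * ((p r + ((d : ℝ) - 1) / 2 / r * F r) ^ 2 + z ^ 2 * F r ^ 2)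

/-- The absolute value of the coefficient of the inverse square potential in the equation of
`r ^ ((d - 1) / 2) F`. -/
noncomputable def liouvilleConst (d : ℕ) : ℝ := |(((d : ℝ) - 1) / 2) ^ 2 - ((d : ℝ) - 1) / 2|

theorem liouvilleConst_nonneg (d : ℕ) : 0 ≤ liouvilleConst d := abs_nonneg _

theorem liouvilleEnergy_nonneg {r : ℝ} (hr : 0 ≤ r) : 0 ≤ liouvilleEnergy d z F p r := by
  unfold liouvilleEnergy
  positivity

/-- With `a = (d - 1) / 2`, `v = r ^ a F` and `v' = r ^ a (p + a / r F)`, the equation `v'' + z² v =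
(a² - a) / r² v` leaves only `2 (a² - a) v v' / r²`. -/
theorem hasDerivAt_liouvilleEnergy (hd : 1 ≤ d) (h : IsRadialProfile d z F p) {r : ℝ}
    (hr : r ∈ Ioo (0 : ℝ) 1) :
    HasDerivAt (liouvilleEnergy d z F p)
      (r ^ (d - 1) * (2 * ((((d : ℝ) - 1) / 2) ^ 2 - ((d : ℝ) - 1) / 2) *
        (p r + ((d : ℝ) - 1) / 2 / r * F r) * F r / r ^ 2)) r := by
  have hr0 : r ≠ 0 := hr.1.ne'
  have hdiv : HasDerivAt (fun s : ℝ => ((d : ℝ) - 1) / 2 / s) (-(((d : ℝ) - 1) / 2) / r ^ 2) r := by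
    simpa [div_eq_mul_inv] using (hasDerivAt_inv hr0).const_mul (((d : ℝ) - 1) / 2)
  refine HasDerivAt.congr_deriv ((hasDerivAt_pow (d - 1) r).fun_mul
    ((((h.hasDerivAt_deriv r hr).fun_add (hdiv.fun_mul (h.hasDerivAt r hr))).fun_pow 2).fun_add
      (((h.hasDerivAt r hr).fun_pow 2).const_mul (z ^ 2)))) ?_
  symm
  obtain ⟨n, rfl⟩ : ∃ n, d = n + 1 := ⟨d - 1, by omega⟩
  simp only [Nat.add_sub_cancel, smul_eq_mul]
  push_cast
  rcases n with _ | n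
  · simp; ring
  · simp only [Nat.add_sub_cancel]
    field_simp
    push_cast
    ring

/-- By `2 |v v'| ≤ (v'² + z² v²) / z`, the logarithmic derivative of the energy is at most `κ / r²`
with `κ = liouvilleConst d / z`. Hence `exp (∓κ / r)` are integrating factors, and the total
variation over `[1 / z, 1]` is bounded independently of `z`. -/
theorem abs_deriv_liouvilleEnergy_le (hz : 0 < z) {r : ℝ} (hr : 0 < r) :
    |r ^ (d - 1) * (2 * ((((d : ℝ) - 1) / 2) ^ 2 - ((d : ℝ) - 1) / 2) *
        (p r + ((d : ℝ) - 1) / 2 / r * F r) * F r / r ^ 2)| ≤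
      liouvilleConst d / z / r ^ 2 * liouvilleEnergy d z F p r := by
  set Q := p r + ((d : ℝ) - 1) / 2 / r * F r
  have h1 : 2 * (|Q| * |F r|) ≤ (Q ^ 2 + z ^ 2 * F r ^ 2) / z := by
    rw [le_div_iff₀ hz, ← sq_abs Q, ← sq_abs (F r)]
    nlinarith [sq_nonneg (|Q| - z * |F r|)]
  have hL := liouvilleConst_nonneg d
  have e : |r ^ (d - 1) * (2 * ((((d : ℝ) - 1) / 2) ^ 2 - ((d : ℝ) - 1) / 2) * Q * F r / r ^ 2)| =
      r ^ (d - 1) / r ^ 2 * liouvilleConst d * (2 * (|Q| * |F r|)) := by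
    rw [abs_mul, abs_div, abs_mul, abs_mul, abs_mul, abs_of_pos (pow_pos hr (d - 1)),
      abs_of_pos (pow_pos hr 2), abs_two, liouvilleConst]
    ring
  rw [e]
  calc _ ≤ r ^ (d - 1) / r ^ 2 * liouvilleConst d * ((Q ^ 2 + z ^ 2 * F r ^ 2) / z) := by gcongr
    _ = _ := by rw [liouvilleEnergy]; ring

theorem continuousOn_liouvilleEnergy (h : IsRadialProfile d z F p) :
    ContinuousOn (liouvilleEnergy d z F p) (Ioc 0 1) := by
  have hF := h.continuousOn.mono Ioc_subset_Icc_self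
  have hp := h.continuousOn_deriv.mono Ioc_subset_Icc_self
  have hdiv : ContinuousOn (fun s : ℝ => ((d : ℝ) - 1) / 2 / s) (Ioc 0 1) :=
    continuousOn_const.div continuousOn_id fun x hx => hx.1.ne'
  exact ContinuousOn.mul (by fun_prop) (((hp.add (hdiv.mul hF)).pow 2).add
    (continuousOn_const.mul (hF.pow 2)))

theorem hasDerivAt_exp_div {κ r : ℝ} (hr : r ≠ 0) :
    HasDerivAt (fun s : ℝ => Real.exp (κ / s)) (Real.exp (κ / r) * (-κ / r ^ 2)) r := by
  have : HasDerivAt (fun s : ℝ => κ / s) (-κ / r ^ 2) r := by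
    simpa [div_eq_mul_inv] using (hasDerivAt_inv hr).const_mul κ
  exact this.exp

theorem continuousOn_exp_div {κ : ℝ} : ContinuousOn (fun s : ℝ => Real.exp (κ / s)) (Ioc 0 1) :=
  (continuousOn_const.div continuousOn_id fun _ hx => hx.1.ne').rexp

theorem monotoneOn_liouvilleEnergy (hd : 1 ≤ d) (hz : 0 < z) (h : IsRadialProfile d z F p) :
    MonotoneOn (fun r => Real.exp (-(liouvilleConst d / z) / r) * liouvilleEnergy d z F p r)
      (Ioc 0 1) := by
  refine monotoneOn_of_hasDerivWithinAt_nonneg (convex_Ioc 0 1)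
    (continuousOn_exp_div.mul h.continuousOn_liouvilleEnergy)
    (f' := fun r => Real.exp (-(liouvilleConst d / z) / r) * (- -(liouvilleConst d / z) / r ^ 2) * liouvilleEnergy d z F p r +
      Real.exp (-(liouvilleConst d / z) / r) * (r ^ (d - 1) * (2 * ((((d : ℝ) - 1) / 2) ^ 2 - ((d : ℝ) - 1) / 2) *
        (p r + ((d : ℝ) - 1) / 2 / r * F r) * F r / r ^ 2))) (fun x hx => ?_) (fun x hx => ?_)
  · rw [interior_Ioc] at hx
    exact ((hasDerivAt_exp_div hx.1.ne').fun_mul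
      (h.hasDerivAt_liouvilleEnergy hd hx)).hasDerivWithinAt
  · rw [interior_Ioc] at hx
    have h1 := neg_le_of_abs_le (abs_deriv_liouvilleEnergy_le (d := d) (F := F) (p := p) hz hx.1)
    have := mul_nonneg (Real.exp_pos (-(liouvilleConst d / z) / x)).le (neg_le_iff_add_nonneg.1 h1)
    rw [neg_neg]
    linarith

theorem antitoneOn_liouvilleEnergy (hd : 1 ≤ d) (hz : 0 < z) (h : IsRadialProfile d z F p) :
    AntitoneOn (fun r => Real.exp (liouvilleConst d / z / r) * liouvilleEnergy d z F p r)
      (Ioc 0 1) := by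
  refine antitoneOn_of_hasDerivWithinAt_nonpos (convex_Ioc 0 1)
    (continuousOn_exp_div.mul h.continuousOn_liouvilleEnergy)
    (f' := fun r => Real.exp ((liouvilleConst d / z) / r) * (-(liouvilleConst d / z) / r ^ 2) * liouvilleEnergy d z F p r +
      Real.exp ((liouvilleConst d / z) / r) * (r ^ (d - 1) * (2 * ((((d : ℝ) - 1) / 2) ^ 2 - ((d : ℝ) - 1) / 2) *
        (p r + ((d : ℝ) - 1) / 2 / r * F r) * F r / r ^ 2))) (fun x hx => ?_) (fun x hx => ?_)
  · rw [interior_Ioc] at hx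
    exact ((hasDerivAt_exp_div hx.1.ne').fun_mul
      (h.hasDerivAt_liouvilleEnergy hd hx)).hasDerivWithinAt
  · rw [interior_Ioc] at hx
    have h1 := le_of_abs_le (abs_deriv_liouvilleEnergy_le (d := d) (F := F) (p := p) hz hx.1)
    have := mul_nonneg (Real.exp_pos (liouvilleConst d / z / x)).le (sub_nonneg.2 h1)
    rw [neg_div]
    linarith

theorem liouvilleEnergy_le_of_le (hd : 1 ≤ d) (hz : 0 < z) (h : IsRadialProfile d z F p)
    {r s : ℝ} (hr : 0 < r) (hrs : r ≤ s) (hs : s ≤ 1) :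
    liouvilleEnergy d z F p r ≤
      Real.exp (liouvilleConst d / z / r) * liouvilleEnergy d z F p s := by
  have h1 := h.monotoneOn_liouvilleEnergy hd hz ⟨hr, hrs.trans hs⟩ ⟨hr.trans_le hrs, hs⟩ hrs
  simp only at h1
  have hκ : 0 ≤ liouvilleConst d / z / s := by
    have := liouvilleConst_nonneg d
    have := hr.trans_le hrs
    positivity
  have h2 : Real.exp (-(liouvilleConst d / z) / s) * liouvilleEnergy d z F p s ≤
      liouvilleEnergy d z F p s :=
    mul_le_of_le_one_left (liouvilleEnergy_nonneg (hr.le.trans hrs))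
      (Real.exp_le_one_iff.2 (by rw [neg_div]; linarith))
  have h3 := h1.trans h2
  rw [neg_div, Real.exp_neg, inv_mul_le_iff₀ (Real.exp_pos _)] at h3
  exact h3

theorem liouvilleEnergy_le_of_ge (hd : 1 ≤ d) (hz : 0 < z) (h : IsRadialProfile d z F p)
    {r s : ℝ} (hr : 0 < r) (hrs : r ≤ s) (hs : s ≤ 1) :
    liouvilleEnergy d z F p s ≤
      Real.exp (liouvilleConst d / z / r) * liouvilleEnergy d z F p r := by
  have h1 := h.antitoneOn_liouvilleEnergy hd hz ⟨hr, hrs.trans hs⟩ ⟨hr.trans_le hrs, hs⟩ hrs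
  refine le_trans ?_ h1
  have := liouvilleConst_nonneg d
  have := hr.trans_le hrs
  exact le_mul_of_one_le_left (liouvilleEnergy_nonneg this.le) (Real.one_le_exp (by positivity))

theorem liouvilleEnergy_one (h1 : F 1 = 0) : liouvilleEnergy d z F p 1 = p 1 ^ 2 := by
  simp [liouvilleEnergy, h1]

theorem exp_liouvilleConst_le {r : ℝ} (hrz : 1 ≤ r * z) :
    Real.exp (liouvilleConst d / z / r) ≤ Real.exp (liouvilleConst d) := by
  rw [Real.exp_le_exp, div_div]
  exact div_le_self (liouvilleConst_nonneg d) (by rwa [mul_comm])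

end IsRadialProfile

/-! ### Pointwise bounds in terms of the `L²` norm. -/

namespace IsRadialProfile

variable {d : ℕ} {z w : ℝ} {F p G q : ℝ → ℝ}

theorem eq_zero_of_apply_zero (hd : 1 ≤ d) (hz : 0 < z) (h : IsRadialProfile d z F p)
    (h0 : F 0 = 0) {r : ℝ} (hr : r ∈ Icc (0 : ℝ) 1) : F r = 0 := by
  have := h.abs_le hd hz hr
  rw [h0, abs_zero] at this
  exact abs_eq_zero.1 (le_antisymm this (abs_nonneg _))

/-- The constant in the pointwise bounds for normalized radial eigenfunctions. -/
noncomputable def boundConst (d : ℕ) : ℝ :=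
  8 * (1 + (((d : ℝ) - 1) / 2) ^ 2) * Real.exp (liouvilleConst d)

theorem boundConst_pos (d : ℕ) : 0 < boundConst d := by
  unfold boundConst
  positivity

theorem le_boundConst (d : ℕ) : 8 * Real.exp (liouvilleConst d) ≤ boundConst d := by
  unfold boundConst
  have := Real.exp_pos (liouvilleConst d)
  nlinarith [mul_nonneg this.le (sq_nonneg (((d : ℝ) - 1) / 2))]

theorem integral_sq_nonneg : 0 ≤ ∫ r in (0 : ℝ)..1, r ^ (d - 1) * F r ^ 2 :=
  intervalIntegral.integral_nonneg zero_le_one fun r hr => by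
    have := hr.1
    positivity

theorem liouvilleEnergy_le (hd : 1 ≤ d) (hz : 0 < z) (h : IsRadialProfile d z F p) (h1 : F 1 = 0)
    {r : ℝ} (hr : r ∈ Ioc (0 : ℝ) 1) (hrz : 1 ≤ r * z) :
    liouvilleEnergy d z F p r ≤ Real.exp (liouvilleConst d) *
      (2 * z ^ 2 * ∫ r in (0 : ℝ)..1, r ^ (d - 1) * F r ^ 2) := by
  rw [← h.deriv_one_sq hd h1, ← liouvilleEnergy_one (d := d) (z := z) h1]
  refine (h.liouvilleEnergy_le_of_le hd hz hr.1 hr.2 le_rfl).trans ?_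
  exact mul_le_mul_of_nonneg_right (exp_liouvilleConst_le hrz) (liouvilleEnergy_nonneg zero_le_one)

theorem pow_mul_sq_le_of_one_le (hd : 1 ≤ d) (hz : 0 < z) (h : IsRadialProfile d z F p)
    (h1 : F 1 = 0) {r : ℝ} (hr : r ∈ Ioc (0 : ℝ) 1) (hrz : 1 ≤ r * z) :
    r ^ (d - 1) * F r ^ 2 ≤ 2 * Real.exp (liouvilleConst d) *
      ∫ r in (0 : ℝ)..1, r ^ (d - 1) * F r ^ 2 := by
  have h2 := h.liouvilleEnergy_le hd hz h1 hr hrz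
  unfold liouvilleEnergy at h2
  have h3 := mul_nonneg (pow_nonneg hr.1.le (d - 1))
    (sq_nonneg (p r + ((d : ℝ) - 1) / 2 / r * F r))
  have hz2 : 0 < z ^ 2 := by positivity
  refine le_of_mul_le_mul_left ?_ hz2
  linarith

/-- The two regimes meet at `r = 1 / z`: there `|F|` is still at least `|F 0| / 2`, and the far
bound already applies. -/
theorem apply_zero_sq_le (hd : 1 ≤ d) (hz : 0 < z) (h : IsRadialProfile d z F p)
    (h1 : F 1 = 0) : F 0 ^ 2 ≤ 8 * Real.exp (liouvilleConst d) * z ^ (d - 1) *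
      ∫ r in (0 : ℝ)..1, r ^ (d - 1) * F r ^ 2 := by
  have hM := integral_sq_nonneg (d := d) (F := F)
  by_cases h0 : F 0 = 0
  · rw [h0, zero_pow two_ne_zero]
    positivity
  have hz1 := h.one_lt_frequency hd hz h1 h0
  have hr : 1 / z ∈ Ioc (0 : ℝ) 1 := ⟨by positivity, by rw [div_le_one hz]; exact hz1.le⟩
  have hrz : 1 / z * z = 1 := by field_simp
  have h2 := h.half_abs_le hd hz ⟨hr.1.le, hr.2⟩ hrz.le
  have h3 := h.pow_mul_sq_le_of_one_le hd hz h1 hr hrz.ge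
  have h4 : F 0 ^ 2 ≤ 4 * F (1 / z) ^ 2 := by
    have := pow_le_pow_left₀ (by positivity) h2 2
    rw [div_pow, sq_abs, sq_abs] at this
    linarith
  have hzp : 0 < z ^ (d - 1) := pow_pos hz _
  rw [one_div, inv_pow, inv_mul_le_iff₀ hzp, ← one_div] at h3
  linarith

theorem sq_le (hd : 1 ≤ d) (hz : 0 < z) (h : IsRadialProfile d z F p)
    (h1 : F 1 = 0) {r : ℝ} (hr : r ∈ Icc (0 : ℝ) 1) :
    F r ^ 2 ≤ boundConst d * z ^ (d - 1) * ∫ r in (0 : ℝ)..1, r ^ (d - 1) * F r ^ 2 := by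
  have hM := integral_sq_nonneg (d := d) (F := F)
  calc F r ^ 2 ≤ F 0 ^ 2 := sq_le_sq.2 (h.abs_le hd hz hr)
    _ ≤ _ := h.apply_zero_sq_le hd hz h1
    _ ≤ _ := by gcongr; exact le_boundConst d

theorem pow_mul_sq_le (hd : 1 ≤ d) (hz : 0 < z) (h : IsRadialProfile d z F p)
    (h1 : F 1 = 0) {r : ℝ} (hr : r ∈ Ioc (0 : ℝ) 1) :
    r ^ (d - 1) * F r ^ 2 ≤ boundConst d * ∫ r in (0 : ℝ)..1, r ^ (d - 1) * F r ^ 2 := by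
  have hM := integral_sq_nonneg (d := d) (F := F)
  have hE := Real.exp_pos (liouvilleConst d)
  have hC := le_boundConst d
  rcases le_total 1 (r * z) with hrz | hrz
  · refine (h.pow_mul_sq_le_of_one_le hd hz h1 hr hrz).trans ?_
    gcongr
    linarith
  · have h2 := h.sq_le hd hz h1 ⟨hr.1.le, hr.2⟩
    have h3 : (r * z) ^ (d - 1) ≤ 1 := pow_le_one₀ (mul_nonneg hr.1.le hz.le) hrz
    calc _ ≤ r ^ (d - 1) * (boundConst d * z ^ (d - 1) *
          ∫ r in (0 : ℝ)..1, r ^ (d - 1) * F r ^ 2) :=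
        mul_le_mul_of_nonneg_left h2 (pow_nonneg hr.1.le _)
      _ = (r * z) ^ (d - 1) * (boundConst d * ∫ r in (0 : ℝ)..1, r ^ (d - 1) * F r ^ 2) := by
        rw [mul_pow]; ring
      _ ≤ _ := mul_le_of_le_one_left (mul_nonneg (boundConst_pos d).le hM) h3

/-- For `r z ≥ 1`, `p` differs from `r ^ (-a) v'` by `a / r F`, which is at most `a z |F|` and so is
also controlled by the Liouville energy. For `r z ≤ 1`, use `|p| ≤ z |F 0|` and the bound at the
origin. -/
theorem pow_mul_deriv_sq_le (hd : 1 ≤ d) (hz : 0 < z) (h : IsRadialProfile d z F p)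
    (h1 : F 1 = 0) {r : ℝ} (hr : r ∈ Ioc (0 : ℝ) 1) :
    r ^ (d - 1) * p r ^ 2 ≤
      boundConst d * z ^ 2 * ∫ r in (0 : ℝ)..1, r ^ (d - 1) * F r ^ 2 := by
  set M := ∫ r in (0 : ℝ)..1, r ^ (d - 1) * F r ^ 2 with hMdef
  have hM : 0 ≤ M := integral_sq_nonneg
  have hrd : 0 ≤ r ^ (d - 1) := pow_nonneg hr.1.le _
  have hE := Real.exp_pos (liouvilleConst d)
  rcases le_total 1 (r * z) with hrz | hrz
  · have h2 := h.liouvilleEnergy_le hd hz h1 hr hrz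
    rw [← hMdef] at h2
    set a := ((d : ℝ) - 1) / 2 with ha
    have h3 : p r ^ 2 ≤ 2 * (1 + a ^ 2) * ((p r + a / r * F r) ^ 2 + z ^ 2 * F r ^ 2) := by
      set Q := p r + a / r * F r with hQ
      have e1 : p r = Q - a / r * F r := by rw [hQ]; ring
      have e2 : (a / r * F r) ^ 2 ≤ a ^ 2 * (z ^ 2 * F r ^ 2) := by
        have : (a / r * F r) ^ 2 = a ^ 2 * ((1 / r) ^ 2 * F r ^ 2) := by ring
        rw [this]
        have : 1 / r ≤ z := by rw [div_le_iff₀ hr.1]; linarith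
        have := hr.1
        gcongr
      have e3 : p r ^ 2 ≤ 2 * Q ^ 2 + 2 * (a / r * F r) ^ 2 := by
        rw [e1]; nlinarith [sq_nonneg (Q + a / r * F r)]
      nlinarith [mul_nonneg (sq_nonneg a) (sq_nonneg Q), mul_nonneg (sq_nonneg z) (sq_nonneg (F r))]
    calc _ ≤ r ^ (d - 1) * (2 * (1 + a ^ 2) * ((p r + a / r * F r) ^ 2 + z ^ 2 * F r ^ 2)) := by
          gcongr
      _ = 2 * (1 + a ^ 2) * liouvilleEnergy d z F p r := by rw [liouvilleEnergy]; ring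
      _ ≤ 2 * (1 + a ^ 2) * (Real.exp (liouvilleConst d) * (2 * z ^ 2 * M)) := by gcongr
      _ ≤ 8 * (1 + a ^ 2) * Real.exp (liouvilleConst d) * z ^ 2 * M := by
          have : 0 ≤ (1 + a ^ 2) * Real.exp (liouvilleConst d) * z ^ 2 * M := by positivity
          linarith
      _ = _ := by rw [boundConst]
  · have h2 := h.deriv_sq_le hd ⟨hr.1.le, hr.2⟩
    have h3 : (r * z) ^ (d - 1) ≤ 1 := pow_le_one₀ (mul_nonneg hr.1.le hz.le) hrz
    have h4 := h.sq_le hd hz h1 (left_mem_Icc.2 zero_le_one)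
    calc _ ≤ r ^ (d - 1) * (z ^ 2 * (boundConst d * z ^ (d - 1) * M)) := by
          refine mul_le_mul_of_nonneg_left (h2.trans ?_) hrd
          gcongr
      _ = (r * z) ^ (d - 1) * (boundConst d * z ^ 2 * M) := by rw [mul_pow]; ring
      _ ≤ _ := mul_le_of_le_one_left
        (mul_nonneg (mul_nonneg (boundConst_pos d).le (sq_nonneg z)) hM) h3

/-! ### Gaps between frequencies and orthogonality. -/

theorem rescale (hz : 0 < z) (hzw : z ≤ w) (h : IsRadialProfile d w F p) :
    IsRadialProfile d z (fun r => F (r * (z / w))) (fun r => p (r * (z / w)) * (z / w)) := by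
  have hw : 0 < w := hz.trans_le hzw
  have hs : 0 < z / w := by positivity
  have hs1 : z / w ≤ 1 := (div_le_one hw).2 hzw
  have hmaps : MapsTo (fun r : ℝ => r * (z / w)) (Icc 0 1) (Icc 0 1) := fun r hr =>
    ⟨mul_nonneg hr.1 hs.le, mul_le_one₀ hr.2 hs.le hs1⟩
  have hmem : ∀ r ∈ Ioo (0 : ℝ) 1, r * (z / w) ∈ Ioo (0 : ℝ) 1 := fun r hr =>
    ⟨mul_pos hr.1 hs, by nlinarith [hr.1, hr.2]⟩
  have hline : ∀ r : ℝ, HasDerivAt (fun r : ℝ => r * (z / w)) (z / w) r := fun r => by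
    simpa using (hasDerivAt_id r).mul_const (z / w)
  refine ⟨h.continuousOn.comp (by fun_prop) hmaps,
    (h.continuousOn_deriv.comp (by fun_prop) hmaps).mul continuousOn_const,
    by simp [h.deriv_zero], fun r hr => (h.hasDerivAt _ (hmem r hr)).comp r (hline r),
    fun r hr => ?_⟩
  refine HasDerivAt.congr_deriv
    (((h.hasDerivAt_deriv _ (hmem r hr)).comp r (hline r)).mul_const (z / w)) ?_
  have := hr.1.ne'
  simp only [smul_eq_mul]
  field_simp

/-- Uniqueness: `F (r z / w) - (F 0 / G 0) G r` solves the equation of frequency `z` and vanishes at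
the origin, hence everywhere. Evaluate at `r = 1`. -/
theorem apply_div_eq_zero (hd : 1 ≤ d) (hz : 0 < z) (hzw : z ≤ w) (hF : IsRadialProfile d w F p)
    (hG : IsRadialProfile d z G q) (hG1 : G 1 = 0) (hG0 : G 0 ≠ 0) : F (z / w) = 0 := by
  have h1 := ((hF.rescale hz hzw).sub_const_mul hG (F 0 / G 0)).eq_zero_of_apply_zero hd hz
    (by simp [hG0]) (right_mem_Icc.2 zero_le_one)
  simpa [hG1] using h1

theorem rpow_sq {r : ℝ} (hd : 1 ≤ d) (hr : 0 < r) :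
    (r ^ (((d : ℝ) - 1) / 2)) ^ 2 = r ^ (d - 1) := by
  rw [← Real.rpow_natCast (r ^ _) 2, ← Real.rpow_mul hr.le, ← Real.rpow_natCast r (d - 1),
    Nat.cast_sub hd]
  congr 1
  push_cast
  ring

/-- Distinct radial frequencies are separated. -/
theorem exp_le_sub (hd : 1 ≤ d) (hz : 0 < z) (hzw : z < w)
    (hF : IsRadialProfile d w F p) (hF1 : F 1 = 0) (hF0 : F 0 ≠ 0)
    (hG : IsRadialProfile d z G q) (hG1 : G 1 = 0) (hG0 : G 0 ≠ 0) :
    Real.exp (-liouvilleConst d) ≤ w - z := by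
  have hw : 0 < w := hz.trans hzw
  have hz1 : 1 < z := hG.one_lt_frequency hd hz hG1 hG0
  have hFs := hF.apply_div_eq_zero hd hz hzw.le hG hG1 hG0
  set s := z / w with hs
  have hs0 : 0 < s := by positivity
  have hs1 : s < 1 := (div_lt_one hw).2 hzw
  set a : ℝ := ((d : ℝ) - 1) / 2 with ha
  set V : ℝ → ℝ := fun r => r ^ a * F r with hV
  have hVd : ∀ r ∈ Ioo (0 : ℝ) 1, HasDerivAt V (r ^ a * (p r + a / r * F r)) r := by
    intro r hr
    refine HasDerivAt.congr_deriv
      ((Real.hasDerivAt_rpow_const (Or.inl hr.1.ne')).fun_mul (hF.hasDerivAt r hr)) ?_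
    rw [Real.rpow_sub_one hr.1.ne']
    have := hr.1.ne'
    field_simp
    ring
  have hVc : ContinuousOn V (Icc s 1) :=
    ContinuousOn.mul (continuousOn_id.rpow_const fun x hx => Or.inl (hs0.trans_le hx.1).ne')
      (hF.continuousOn.mono (Icc_subset_Icc_left hs0.le))
  -- Rolle between the zeros `z / w` and `1` of `V = r ^ a F`. At `ξ` the energy is purely `w²
  -- V(ξ)²`, so afterwards `|V'|` is at most `E w |V ξ|`; descending from `|V ξ|` to `0` by time `1`
  -- forces `1 ≤ E w (1 - ξ) ≤ E (w - z)`.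
  obtain ⟨ξ, hξ, hξ0⟩ := exists_hasDerivAt_eq_zero hs1 hVc (by simp [hV, hFs, hF1])
    (fun x hx => hVd x ⟨hs0.trans hx.1, hx.2⟩)
  have hξp : 0 < ξ := hs0.trans hξ.1
  have hQ : p ξ + a / ξ * F ξ = 0 :=
    (mul_eq_zero.1 hξ0).resolve_left (Real.rpow_pos_of_pos hξp a).ne'
  have hW : liouvilleEnergy d w F p ξ = w ^ 2 * V ξ ^ 2 := by
    rw [liouvilleEnergy, ← ha, hQ, hV, mul_pow, rpow_sq hd hξp]
    ring
  have hξw : 1 ≤ ξ * w := by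
    have := (div_lt_iff₀ hw).1 hξ.1
    linarith
  set E := Real.exp (liouvilleConst d) with hE
  have hE1 : 1 ≤ E := Real.one_le_exp (liouvilleConst_nonneg d)
  have hWr : ∀ r ∈ Icc ξ 1, liouvilleEnergy d w F p r ≤ E * (w ^ 2 * V ξ ^ 2) := by
    intro r hr
    rw [← hW]
    exact (hF.liouvilleEnergy_le_of_ge hd hw hξp hr.1 hr.2).trans
      (mul_le_mul_of_nonneg_right (exp_liouvilleConst_le hξw) (liouvilleEnergy_nonneg hξp.le))
  have hbound : ∀ r ∈ Ico ξ 1, ‖r ^ a * (p r + a / r * F r)‖ ≤ E * w * |V ξ| := by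
    intro r hr
    have hrp := hξp.trans_le hr.1
    rw [Real.norm_eq_abs]
    refine abs_le_of_sq_le_sq ?_ (by positivity)
    have h1 := hWr r ⟨hr.1, hr.2.le⟩
    rw [liouvilleEnergy, ← ha] at h1
    have h2 : 0 ≤ r ^ (d - 1) * (w ^ 2 * F r ^ 2) := by positivity
    calc _ = r ^ (d - 1) * (p r + a / r * F r) ^ 2 := by rw [mul_pow, rpow_sq hd hrp]
      _ ≤ E * (w ^ 2 * V ξ ^ 2) := by linarith
      _ ≤ E ^ 2 * (w ^ 2 * V ξ ^ 2) := by gcongr; nlinarith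
      _ = _ := by rw [mul_pow, mul_pow, sq_abs]; ring
  have hmv := norm_image_sub_le_of_norm_deriv_right_le_segment (f := V) (a := ξ) (b := 1)
    (f' := fun r => r ^ a * (p r + a / r * F r))
    (C := E * w * |V ξ|) (hVc.mono (Icc_subset_Icc_left hξ.1.le)) (fun x hx => ?_) hbound 1 (right_mem_Icc.2 hξ.2.le)
  · have hV1 : V 1 = 0 := by simp [hV, hF1]
    rw [hV1, zero_sub, norm_neg, Real.norm_eq_abs] at hmv
    -- If `V ξ = 0`, the energy vanishes at `1`, Pohozaev's identity makes the `L²` norm zero, and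
    -- `apply_zero_sq_le` contradicts `F 0 ≠ 0`.
    have hVξ : 0 < |V ξ| := by
      rw [abs_pos]
      intro hV0
      have h1 := hWr 1 (right_mem_Icc.2 hξ.2.le)
      rw [liouvilleEnergy_one hF1, hF.deriv_one_sq hd hF1, hV0] at h1
      have h2 : ∫ r in (0 : ℝ)..1, r ^ (d - 1) * F r ^ 2 ≤ 0 := by
        by_contra hc
        push Not at hc
        have : 0 < 2 * w ^ 2 * ∫ r in (0 : ℝ)..1, r ^ (d - 1) * F r ^ 2 := by positivity
        nlinarith
      have h3 := hF.apply_zero_sq_le hd hw hF1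
      have h4 : 0 < F 0 ^ 2 := by positivity
      have h5 : 0 < 8 * E * w ^ (d - 1) := by positivity
      nlinarith
    have h3 : 1 ≤ E * (w - z) := by
      have h4 : w * (1 - ξ) ≤ w - z := by
        have := (div_lt_iff₀ hw).1 hξ.1
        linarith
      have h5 : |V ξ| * 1 ≤ |V ξ| * (E * (w - z)) := by
        calc |V ξ| * 1 ≤ E * w * |V ξ| * (1 - ξ) := by linarith
          _ = |V ξ| * (E * (w * (1 - ξ))) := by ring
          _ ≤ _ := by gcongr
      exact le_of_mul_le_mul_left h5 hVξ
    rw [Real.exp_neg, inv_le_iff_one_le_mul₀ (by positivity), mul_comm]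
    exact h3
  · exact (hVd x ⟨hξp.trans_le hx.1, hx.2⟩).hasDerivWithinAt

/-- Radial eigenfunctions of different frequencies are orthogonal. -/
theorem integral_mul_eq_zero {F p G q : ℝ → ℂ} (hd : 1 ≤ d) (hF : IsRadialProfile d z F p)
    (hF1 : F 1 = 0) (hG : IsRadialProfile d w G q) (hG1 : G 1 = 0) (hzw : z ^ 2 ≠ w ^ 2) :
    ∫ r in (0 : ℝ)..1, (r : ℂ) ^ (d - 1) * (F r * G r) = 0 := by
  have hi : IntervalIntegrable (fun r : ℝ => ((z : ℂ) ^ 2 - w ^ 2) *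
      ((r : ℂ) ^ (d - 1) * (F r * G r))) volume 0 1 := by
    apply ContinuousOn.intervalIntegrable_of_Icc zero_le_one
    exact continuousOn_const.mul (ContinuousOn.mul (by fun_prop)
      (hF.continuousOn.mul hG.continuousOn))
  -- Green's identity: the primitive is the weighted Wronskian, zero at both ends.
  have key := intervalIntegral.integral_eq_sub_of_hasDerivAt_of_le (zero_le_one (α := ℝ))
    (f := fun s : ℝ => F s * ((s : ℂ) ^ (d - 1) * q s) - G s * ((s : ℂ) ^ (d - 1) * p s))
    (f' := fun r : ℝ => ((z : ℂ) ^ 2 - w ^ 2) * ((r : ℂ) ^ (d - 1) * (F r * G r))) ?_ ?_ hi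
  · simp only [intervalIntegral.integral_const_mul, hF.deriv_zero, hG.deriv_zero, hF1, hG1] at key
    simp only [zero_mul, mul_zero, sub_self] at key
    refine (mul_eq_zero.1 key).resolve_left (sub_ne_zero.2 ?_)
    exact_mod_cast hzw
  · exact (hF.continuousOn.mul (ContinuousOn.mul (by fun_prop) hG.continuousOn_deriv)).sub
      (hG.continuousOn.mul (ContinuousOn.mul (by fun_prop) hF.continuousOn_deriv))
  · intro r hr
    refine HasDerivAt.congr_deriv
      (((hF.hasDerivAt r hr).fun_mul (hG.hasDerivAt_pow_mul_deriv hd hr)).fun_sub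
        ((hG.hasDerivAt r hr).fun_mul (hF.hasDerivAt_pow_mul_deriv hd hr))) ?_
    ring

end IsRadialProfile

/-! ### Polar coordinates and complex-valued profiles. -/

/-- The surface area of the unit sphere of `ℝ^d`. -/
noncomputable def sphereArea (d : ℕ) : ℝ :=
  d * volume.real (unitBall d)

theorem sphereArea_pos {d : ℕ} (hd : 1 ≤ d) : 0 < sphereArea d := by
  have h1 : 0 < volume.real (unitBall d) :=
    ENNReal.toReal_pos (Metric.measure_ball_pos volume _ one_pos).ne' measure_ball_lt_top.ne
  have h2 : (0 : ℝ) < d := by exact_mod_cast hd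
  exact mul_pos h2 h1

theorem setIntegral_unitBall_norm {d : ℕ} (hd : 1 ≤ d) {V : Type*} [NormedAddCommGroup V]
    [NormedSpace ℝ V] (g : ℝ → V) :
    ∫ x in unitBall d, g ‖x‖ = sphereArea d • ∫ r in (0 : ℝ)..1, r ^ (d - 1) • g r := by
  have : Nonempty (Fin d) := ⟨⟨0, hd⟩⟩
  have h1 : ∀ x : EuclideanSpace ℝ (Fin d),
      (unitBall d).indicator (fun x => g ‖x‖) x = (Iio 1).indicator g ‖x‖ := by
    intro x
    simp [indicator, unitBall]
  rw [← integral_indicator (isOpen_unitBall d).measurableSet]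
  simp_rw [h1]
  rw [integral_fun_norm_addHaar, finrank_euclideanSpace_fin, sphereArea, mul_smul,
    ← Nat.cast_smul_eq_nsmul ℝ]
  congr 2
  have h2 : ∀ y : ℝ, y ^ (d - 1) • (Iio 1).indicator g y =
      (Iio 1).indicator (fun y => y ^ (d - 1) • g y) y := by
    intro y
    by_cases hy : y < 1 <;> simp [indicator, hy]
  simp_rw [h2]
  rw [setIntegral_indicator measurableSet_Iio, Ioi_inter_Iio,
    intervalIntegral.integral_of_le zero_le_one, integral_Ioc_eq_integral_Ioo]

theorem inner_eq_intervalIntegral {d : ℕ} (hd : 1 ≤ d) {v w : L2Ball d}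
    {f g : EuclideanSpace ℝ (Fin d) → ℂ} {F G : ℝ → ℂ} (hv : v =ᵐ[ballMeasure d] f)
    (hw : w =ᵐ[ballMeasure d] g) (hf : ∀ x ∈ unitBall d, f x = F ‖x‖)
    (hg : ∀ x ∈ unitBall d, g x = G ‖x‖) :
    ⟪v, w⟫_ℂ = sphereArea d •
      ∫ r in (0 : ℝ)..1, (r : ℂ) ^ (d - 1) * ((starRingEnd ℂ) (F r) * G r) := by
  rw [L2.inner_def]
  have h1 : ∫ x, ⟪v x, w x⟫_ℂ ∂ballMeasure d =
      ∫ x in unitBall d, (fun r => (starRingEnd ℂ) (F r) * G r) ‖x‖ := by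
    refine integral_congr_ae ?_
    filter_upwards [hv, hw, ae_restrict_mem (isOpen_unitBall d).measurableSet] with x h1 h2 h3
    rw [h1, h2, hf x h3, hg x h3]
    simp [mul_comm]
  rw [h1]
  refine (setIntegral_unitBall_norm hd fun r => (starRingEnd ℂ) (F r) * G r).trans ?_
  simp [Complex.real_smul]

theorem norm_sq_eq_intervalIntegral {d : ℕ} (hd : 1 ≤ d) {v : L2Ball d}
    {f : EuclideanSpace ℝ (Fin d) → ℂ} {F : ℝ → ℂ} (hv : v =ᵐ[ballMeasure d] f)
    (hf : ∀ x ∈ unitBall d, f x = F ‖x‖) :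
    ‖v‖ ^ 2 = sphereArea d * ∫ r in (0 : ℝ)..1, r ^ (d - 1) * ‖F r‖ ^ 2 := by
  have h1 := inner_eq_intervalIntegral hd hv hv hf hf
  rw [inner_self_eq_norm_sq_to_K] at h1
  have h2 : ∀ r : ℝ, (r : ℂ) ^ (d - 1) * ((starRingEnd ℂ) (F r) * F r) =
      ((r ^ (d - 1) * ‖F r‖ ^ 2 : ℝ) : ℂ) := by
    intro r
    rw [Complex.conj_mul']
    push_cast
    rfl
  simp_rw [h2] at h1
  rw [intervalIntegral.integral_ofReal, Complex.real_smul] at h1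
  refine Complex.ofReal_injective ?_
  rw [Complex.ofReal_pow, Complex.ofReal_mul]
  exact h1

/-- The classical gradient of a complex-valued function. -/
noncomputable def complexGradient {d : ℕ} (f : EuclideanSpace ℝ (Fin d) → ℂ)
    (x : EuclideanSpace ℝ (Fin d)) : EuclideanSpace ℂ (Fin d) :=
  WithLp.toLp 2 fun i => fderiv ℝ f x (EuclideanSpace.single i 1)

namespace IsRadialProfile

variable {d : ℕ} {z w : ℝ} {F p : ℝ → ℂ}

theorem integral_norm_sq (h : IsRadialProfile d z F p) :
    ∫ r in (0 : ℝ)..1, r ^ (d - 1) * ‖F r‖ ^ 2 =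
      (∫ r in (0 : ℝ)..1, r ^ (d - 1) * (F r).re ^ 2) +
        ∫ r in (0 : ℝ)..1, r ^ (d - 1) * (F r).im ^ 2 := by
  rw [← intervalIntegral.integral_add]
  · refine intervalIntegral.integral_congr fun r _ => ?_
    simp only [← Complex.normSq_eq_norm_sq, Complex.normSq_apply]
    ring
  · apply ContinuousOn.intervalIntegrable_of_Icc zero_le_one
    exact ContinuousOn.mul (by fun_prop) ((h.map Complex.reCLM).continuousOn.pow 2)
  · apply ContinuousOn.intervalIntegrable_of_Icc zero_le_one
    exact ContinuousOn.mul (by fun_prop) ((h.map Complex.imCLM).continuousOn.pow 2)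

theorem re (h : IsRadialProfile d z F p) :
    IsRadialProfile d z (fun r => (F r).re) (fun r => (p r).re) := h.map Complex.reCLM

theorem im (h : IsRadialProfile d z F p) :
    IsRadialProfile d z (fun r => (F r).im) (fun r => (p r).im) := h.map Complex.imCLM

theorem norm_sq_le (hd : 1 ≤ d) (hz : 0 < z) (h : IsRadialProfile d z F p)
    (h1 : F 1 = 0) {r : ℝ} (hr : r ∈ Icc (0 : ℝ) 1) :
    ‖F r‖ ^ 2 ≤ boundConst d * z ^ (d - 1) * ∫ r in (0 : ℝ)..1, r ^ (d - 1) * ‖F r‖ ^ 2 := by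
  have a := h.re.sq_le hd hz (by simp [h1]) hr
  have b := h.im.sq_le hd hz (by simp [h1]) hr
  rw [h.integral_norm_sq, ← Complex.normSq_eq_norm_sq, Complex.normSq_apply]
  linarith

theorem pow_mul_norm_sq_le (hd : 1 ≤ d) (hz : 0 < z) (h : IsRadialProfile d z F p)
    (h1 : F 1 = 0) {r : ℝ} (hr : r ∈ Ioc (0 : ℝ) 1) :
    r ^ (d - 1) * ‖F r‖ ^ 2 ≤ boundConst d * ∫ r in (0 : ℝ)..1, r ^ (d - 1) * ‖F r‖ ^ 2 := by
  have a := h.re.pow_mul_sq_le hd hz (by simp [h1]) hr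
  have b := h.im.pow_mul_sq_le hd hz (by simp [h1]) hr
  rw [h.integral_norm_sq, ← Complex.normSq_eq_norm_sq, Complex.normSq_apply]
  linarith

theorem pow_mul_norm_deriv_sq_le (hd : 1 ≤ d) (hz : 0 < z) (h : IsRadialProfile d z F p)
    (h1 : F 1 = 0) {r : ℝ} (hr : r ∈ Ioc (0 : ℝ) 1) :
    r ^ (d - 1) * ‖p r‖ ^ 2 ≤
      boundConst d * z ^ 2 * ∫ r in (0 : ℝ)..1, r ^ (d - 1) * ‖F r‖ ^ 2 := by
  have a := h.re.pow_mul_deriv_sq_le hd hz (by simp [h1]) hr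
  have b := h.im.pow_mul_deriv_sq_le hd hz (by simp [h1]) hr
  rw [h.integral_norm_sq, ← Complex.normSq_eq_norm_sq, Complex.normSq_apply]
  linarith

theorem eq_zero_of_apply_zero_complex (hd : 1 ≤ d) (hz : 0 < z) (h : IsRadialProfile d z F p)
    (h0 : F 0 = 0) {r : ℝ} (hr : r ∈ Icc (0 : ℝ) 1) : F r = 0 :=
  Complex.ext (h.re.eq_zero_of_apply_zero hd hz (by simp [h0]) hr)
    (h.im.eq_zero_of_apply_zero hd hz (by simp [h0]) hr)

end IsRadialProfile

/-! ### Integration by parts against test functions. -/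

section IntegrationByParts

variable {E V : Type*} [NormedAddCommGroup E] [MeasurableSpace E] [BorelSpace E]
  [NormedAddCommGroup V] [NormedSpace ℝ V]

theorem integrable_smul_of_tsupport_subset {μ : Measure E} [IsFiniteMeasureOnCompacts μ]
    {ψ φ : E → ℝ} {k : E → V} {U : Set E} (hU : IsOpen U) (hφc : HasCompactSupport φ)
    (hφU : tsupport φ ⊆ U) (hψ : Continuous ψ) (hs : tsupport ψ ⊆ tsupport φ)
    (hk : ContinuousOn k U) : Integrable (fun x => ψ x • k x) μ := by
  have hψc : HasCompactSupport ψ := hφc.mono' (subset_closure.trans hs)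
  refine Continuous.integrable_of_hasCompactSupport ?_ (HasCompactSupport.smul_right hψc)
  exact (hψ.continuousOn.smul hk).continuous_of_tsupport_subset hU
    ((tsupport_smul_subset_left ψ k).trans (hs.trans hφU))

theorem integral_smul_fderiv_eq_neg_of_tsupport_subset [NormedSpace ℝ E]
    [FiniteDimensional ℝ E] {μ : Measure E} [μ.IsAddHaarMeasure]
    {φ : E → ℝ} {f : E → V} {U : Set E} (hU : IsOpen U) (hφ : ContDiff ℝ 1 φ)
    (hφc : HasCompactSupport φ) (hφU : tsupport φ ⊆ U) (hf : ContDiffOn ℝ 1 f U) (v : E) :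
    ∫ x, φ x • fderiv ℝ f x v ∂μ = -∫ x, fderiv ℝ φ x v • f x ∂μ := by
  have hφd : Continuous fun x => fderiv ℝ φ x v :=
    (hφ.continuous_fderiv one_ne_zero).clm_apply continuous_const
  have hfd : ContinuousOn (fun x => fderiv ℝ f x v) U :=
    (hf.continuousOn_fderiv_of_isOpen hU le_rfl).clm_apply continuousOn_const
  refine integral_bilinear_hasFDerivAt_right_eq_neg_left_of_integrable (μ := μ)
    (f := φ) (f' := fderiv ℝ φ) (g := f) (g' := fderiv ℝ f) (v := v)
    (B := ContinuousLinearMap.lsmul ℝ ℝ) ?_ ?_ ?_ ?_ ?_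
  · exact integrable_smul_of_tsupport_subset hU hφc hφU hφd
      (tsupport_fderiv_apply_subset ℝ v) hf.continuousOn
  · exact integrable_smul_of_tsupport_subset hU hφc hφU hφ.continuous le_rfl hfd
  · exact integrable_smul_of_tsupport_subset hU hφc hφU hφ.continuous le_rfl hf.continuousOn
  · exact fun x _ => (hφ.differentiable one_ne_zero x).hasFDerivAt
  · exact fun x hx => ((hf.contDiffAt (hU.mem_nhds (hφU hx))).differentiableAt
      one_ne_zero).hasFDerivAt

end IntegrationByParts

/-! ### Bounds for eigenfunctions and their gradients on the ball. -/

namespace IsRadialDirichletSolution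

open IsRadialProfile (boundConst)

variable {d : ℕ} {z w : ℝ} {f g : EuclideanSpace ℝ (Fin d) → ℂ} {v : L2Ball d}

theorem norm_complexGradient_le {p : ℝ → ℂ} {x : EuclideanSpace ℝ (Fin d)}
    (h : ∀ v, fderiv ℝ f x v = (⟪x, v⟫_ℝ / ‖x‖) • p ‖x‖) :
    ‖complexGradient f x‖ ≤ ‖p ‖x‖‖ := by
  refine le_of_sq_le_sq ?_ (norm_nonneg _)
  rw [EuclideanSpace.norm_sq_eq]
  have h1 : ∀ i, ‖complexGradient f x i‖ ^ 2 = ‖x i‖ ^ 2 * (‖p ‖x‖‖ ^ 2 / ‖x‖ ^ 2) := by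
    intro i
    simp only [complexGradient, h, norm_smul, EuclideanSpace.inner_single_right]
    simp only [norm_div, norm_norm, conj_trivial, one_mul]
    ring
  simp_rw [h1]
  rw [← Finset.sum_mul, ← EuclideanSpace.norm_sq_eq]
  by_cases hx : ‖x‖ = 0
  · simp [hx]
  · rw [mul_div_cancel₀]
    positivity

theorem norm_sq_le (hd : 1 ≤ d) (hz : 0 < z) (hf : IsRadialDirichletSolution d z f)
    (hv : v =ᵐ[ballMeasure d] f) {x : EuclideanSpace ℝ (Fin d)} (hx : x ∈ unitBall d) :
    ‖f x‖ ^ 2 ≤ boundConst d / sphereArea d * z ^ (d - 1) * ‖v‖ ^ 2 := by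
  obtain ⟨F, p, h, h1, hF, -⟩ := hf.exists_isRadialProfile hd
  have hS := (sphereArea_pos hd).ne'
  have hx1 : ‖x‖ < 1 := by simpa [unitBall] using hx
  rw [hF x hx, norm_sq_eq_intervalIntegral hd hv hF]
  refine (h.norm_sq_le hd hz h1 ⟨norm_nonneg _, hx1.le⟩).trans_eq ?_
  field_simp

theorem pow_mul_norm_sq_le (hd : 1 ≤ d) (hz : 0 < z) (hf : IsRadialDirichletSolution d z f)
    (hv : v =ᵐ[ballMeasure d] f) {x : EuclideanSpace ℝ (Fin d)} (hx : x ∈ unitBall d)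
    (hx0 : x ≠ 0) :
    ‖x‖ ^ (d - 1) * ‖f x‖ ^ 2 ≤ boundConst d / sphereArea d * ‖v‖ ^ 2 := by
  obtain ⟨F, p, h, h1, hF, -⟩ := hf.exists_isRadialProfile hd
  have hS := (sphereArea_pos hd).ne'
  have hx1 : ‖x‖ < 1 := by simpa [unitBall] using hx
  rw [hF x hx, norm_sq_eq_intervalIntegral hd hv hF]
  refine (h.pow_mul_norm_sq_le hd hz h1 ⟨norm_pos_iff.2 hx0, hx1.le⟩).trans_eq ?_
  field_simp

theorem pow_mul_norm_complexGradient_sq_le (hd : 1 ≤ d) (hz : 0 < z)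
    (hf : IsRadialDirichletSolution d z f) (hv : v =ᵐ[ballMeasure d] f)
    {x : EuclideanSpace ℝ (Fin d)} (hx : x ∈ unitBall d) (hx0 : x ≠ 0) :
    ‖x‖ ^ (d - 1) * ‖complexGradient f x‖ ^ 2 ≤
      boundConst d / sphereArea d * z ^ 2 * ‖v‖ ^ 2 := by
  obtain ⟨F, p, h, h1, hF, hp⟩ := hf.exists_isRadialProfile hd
  have hS := (sphereArea_pos hd).ne'
  have hx1 : ‖x‖ < 1 := by simpa [unitBall] using hx
  have hg := norm_complexGradient_le (hp x hx)
  rw [norm_sq_eq_intervalIntegral hd hv hF]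
  calc _ ≤ ‖x‖ ^ (d - 1) * ‖p ‖x‖‖ ^ 2 := by gcongr
    _ ≤ _ := h.pow_mul_norm_deriv_sq_le hd hz h1 ⟨norm_pos_iff.2 hx0, hx1.le⟩
    _ = _ := by field_simp

theorem continuousOn_complexGradient (hf : IsRadialDirichletSolution d z f) :
    ContinuousOn (complexGradient f) (unitBall d) := by
  intro x hx
  have h1 : ∀ i : Fin d, ContinuousAt
      (fun y => fderiv ℝ f y (EuclideanSpace.single i 1)) x := fun i =>
    (hf.differentiableAt_fderiv hx).continuousAt.clm_apply continuousAt_const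
  refine ContinuousAt.continuousWithinAt ?_
  exact (PiLp.continuous_toLp 2 _).continuousAt.comp (continuousAt_pi.2 h1)

theorem memLp_complexGradient (hd : 1 ≤ d) (hf : IsRadialDirichletSolution d z f) :
    MemLp (complexGradient f) 2 (ballMeasure d) := by
  obtain ⟨F, p, h, h1, hF, hp⟩ := hf.exists_isRadialProfile hd
  obtain ⟨C, hC⟩ := (isCompact_Icc.bddAbove_image h.continuousOn_deriv.norm)
  have : IsFiniteMeasure (ballMeasure d) := ⟨by
    rw [ballMeasure, Measure.restrict_apply_univ]; exact measure_ball_lt_top⟩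
  refine MemLp.of_bound
    (hf.continuousOn_complexGradient.aestronglyMeasurable (isOpen_unitBall d).measurableSet) C ?_
  filter_upwards [ae_restrict_mem (isOpen_unitBall d).measurableSet] with x hx
  have hx1 : ‖x‖ < 1 := by simpa [unitBall] using hx
  exact (norm_complexGradient_le (hp x hx)).trans
    (hC ⟨‖x‖, ⟨norm_nonneg _, hx1.le⟩, rfl⟩)

theorem eq_zero_of_apply_zero (hd : 1 ≤ d) (hz : 0 < z) (hf : IsRadialDirichletSolution d z f)
    (h0 : f 0 = 0) {x : EuclideanSpace ℝ (Fin d)} (hx : x ∈ unitBall d) : f x = 0 := by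
  obtain ⟨F, p, h, h1, hF, -⟩ := hf.exists_isRadialProfile hd
  have hx1 : ‖x‖ < 1 := by simpa [unitBall] using hx
  rw [hF x hx]
  refine h.eq_zero_of_apply_zero_complex hd hz ?_ ⟨norm_nonneg _, hx1.le⟩
  rw [← norm_zero (E := EuclideanSpace ℝ (Fin d)), ← hF 0 (by simp [unitBall]), h0]

/-- A solution has a weak gradient, namely the classical one. -/
theorem integral_fderiv_mul (hf : IsRadialDirichletSolution d z f)
    {φ : EuclideanSpace ℝ (Fin d) → ℝ} (hφ : ContDiff ℝ ∞ φ) (hφc : HasCompactSupport φ)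
    (hφs : tsupport φ ⊆ unitBall d) (i : Fin d) :
    ∫ x in unitBall d, ((fderiv ℝ φ x (EuclideanSpace.single i 1) : ℝ) : ℂ) * f x =
      -∫ x in unitBall d, ((φ x : ℝ) : ℂ) * complexGradient f x i := by
  set e : EuclideanSpace ℝ (Fin d) := EuclideanSpace.single i 1
  have hzero : ∀ x ∉ unitBall d, φ x = 0 := fun x hx =>
    image_eq_zero_of_notMem_tsupport fun h => hx (hφs h)
  have hzero' : ∀ x ∉ unitBall d, fderiv ℝ φ x = 0 := fun x hx =>
    image_eq_zero_of_notMem_tsupport fun h => hx (hφs (tsupport_fderiv_subset ℝ h))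
  rw [setIntegral_eq_integral_of_forall_compl_eq_zero (fun x hx => by simp [hzero' x hx]),
    setIntegral_eq_integral_of_forall_compl_eq_zero (fun x hx => by simp [hzero x hx])]
  have key := integral_smul_fderiv_eq_neg_of_tsupport_subset (μ := volume) (isOpen_unitBall d)
    (hφ.of_le (by simp)) hφc hφs (hf.contDiffOn.of_le (by norm_num)) e
  simp only [Complex.real_smul] at key
  simp only [complexGradient]
  rw [key, neg_neg]

end IsRadialDirichletSolution

/-! ### Separated sets. -/

/-- The points of `S`, in increasing order, are at distance at least `c` under `φ`. -/
def SeparatedOn (c : ℝ) (φ : ℝ → ℝ) (S : Set ℝ) : Prop :=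
  ∀ x ∈ S, ∀ y ∈ S, x < y → c ≤ φ y - φ x

/-- Each cell `[a + k c, a + (k + 1) c)` contains at most one value of `φ`. Finiteness, counting and
summation over separated sets all reduce to integers this way. -/
theorem SeparatedOn.injOn_floor {c : ℝ} {φ : ℝ → ℝ} {S : Set ℝ} (h : SeparatedOn c φ S)
    (hc : 0 < c) (a : ℝ) : InjOn (fun x => ⌊(φ x - a) / c⌋) S := by
  have key : ∀ x ∈ S, ∀ y ∈ S, x < y → ⌊(φ x - a) / c⌋ ≠ ⌊(φ y - a) / c⌋ := by
    intro x hx y hy hxy heq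
    have h1 := Int.abs_sub_lt_one_of_floor_eq_floor heq
    rw [← sub_div, abs_div, abs_of_pos hc, div_lt_one hc] at h1
    have h2 := h x hx y hy hxy
    have h3 := (abs_lt.1 h1).1
    linarith
  intro x hx y hy hxy
  rcases lt_trichotomy x y with h1 | h1 | h1
  · exact absurd hxy (key x hx y hy h1)
  · exact h1
  · exact absurd hxy.symm (key y hy x hx h1)

theorem SeparatedOn.finite_inter_Icc {c : ℝ} {S : Set ℝ} (h : SeparatedOn c id S)
    (hc : 0 < c) (a b : ℝ) : (S ∩ Icc a b).Finite := by
  have hi : InjOn (fun x : ℝ => ⌊(id x - a) / c⌋) (S ∩ Icc a b) :=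
    (h.injOn_floor hc a).mono inter_subset_left
  refine Set.Finite.of_finite_image (Set.Finite.subset (Set.finite_Icc 0 ⌊(b - a) / c⌋) ?_) hi
  rintro _ ⟨x, hx, rfl⟩
  exact ⟨Int.floor_nonneg.2 (div_nonneg (sub_nonneg.2 hx.2.1) hc.le),
    Int.floor_le_floor (by have := hx.2.2; simp only [id]; gcongr)⟩

theorem SeparatedOn.card_le {c : ℝ} {T : Finset ℝ} (h : SeparatedOn c id T)
    (hc : 0 < c) {a b : ℝ} (hab : a ≤ b) (hT : ∀ x ∈ T, x ∈ Icc a b) :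
    (T.card : ℝ) ≤ (b - a) / c + 1 := by
  have h1 : T.card ≤ (Finset.Icc (0 : ℤ) ⌊(b - a) / c⌋).card := by
    refine Finset.card_le_card_of_injOn (fun x => ⌊(id x - a) / c⌋) (fun x hx => ?_)
      (h.injOn_floor hc a)
    have hx' := hT x hx
    simp only [Finset.coe_Icc]
    exact ⟨Int.floor_nonneg.2 (div_nonneg (sub_nonneg.2 hx'.1) hc.le),
      Int.floor_le_floor (by have := hx'.2; simp only [id]; gcongr)⟩
  have h0 : 0 ≤ ⌊(b - a) / c⌋ := Int.floor_nonneg.2 (div_nonneg (sub_nonneg.2 hab) hc.le)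
  rw [Int.card_Icc] at h1
  have h2 : ((T.card : ℤ) : ℝ) ≤ ((⌊(b - a) / c⌋ + 1 : ℤ) : ℝ) := by
    exact_mod_cast (by omega : (T.card : ℤ) ≤ ⌊(b - a) / c⌋ + 1)
  push_cast at h2
  linarith [Int.floor_le ((b - a) / c)]

/-! ### Eigenspaces, the frequency set and the finite spectral expansion. -/

section Eigenspaces

variable {d : ℕ} {z w : ℝ}

/-- A solution is determined by its value at the origin: subtract the multiple of `f₀` with the same
value there. If no solution is nonzero at the origin, all vanish. -/
theorem radialEigenspace_le_span (hd : 1 ≤ d) (hz : 0 < z) :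
    ∃ v : L2Ball d, radialEigenspace d z ≤ Submodule.span ℂ {v} := by
  by_cases h : ∃ f₀ v₀, IsRadialDirichletSolution d z f₀ ∧ f₀ 0 ≠ 0 ∧
    (v₀ : L2Ball d) =ᵐ[ballMeasure d] f₀
  · obtain ⟨f₀, v₀, hf₀, h0, hv₀⟩ := h
    refine ⟨v₀, ?_⟩
    rintro v ⟨f, hf, hv⟩
    rw [Submodule.mem_span_singleton]
    refine ⟨f 0 / f₀ 0, Lp.ext ?_⟩
    filter_upwards [hv, hv₀, Lp.coeFn_smul (f 0 / f₀ 0) v₀,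
      ae_restrict_mem (isOpen_unitBall d).measurableSet] with x h1 h2 h3 hx
    have hs := hf.add (hf₀.smul (-(f 0 / f₀ 0)))
    have h4 := hs.eq_zero_of_apply_zero hd hz (by simp [h0]) hx
    simp only [Pi.add_apply, Pi.smul_apply, smul_eq_mul] at h4
    rw [h3, Pi.smul_apply, h2, h1, smul_eq_mul]
    linear_combination -h4
  · push Not at h
    refine ⟨0, ?_⟩
    rintro v ⟨f, hf, hv⟩
    rw [Submodule.span_zero_singleton, Submodule.mem_bot]
    have hf0 : f 0 = 0 := by
      by_contra h0
      exact h f v hf h0 hv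
    refine Lp.ext ?_
    filter_upwards [hv, Lp.coeFn_zero ℂ 2 (ballMeasure d),
      ae_restrict_mem (isOpen_unitBall d).measurableSet] with x h1 h2 hx
    rw [h1, h2, hf.eq_zero_of_apply_zero hd hz hf0 hx, Pi.zero_apply]

theorem topologicalClosure_radialEigenspace (hd : 1 ≤ d) (hz : 0 < z) :
    (radialEigenspace d z).topologicalClosure = radialEigenspace d z := by
  obtain ⟨v, hv⟩ := radialEigenspace_le_span hd hz
  have : FiniteDimensional ℂ (radialEigenspace d z) := Submodule.finiteDimensional_of_le hv
  exact (Submodule.closed_of_finiteDimensional _).submodule_topologicalClosure_eq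

theorem eigenProj_mem (hd : 1 ≤ d) (hz : 0 < z) (u : L2Ball d) :
    eigenProj d z u ∈ radialEigenspace d z := by
  rw [← topologicalClosure_radialEigenspace hd hz]
  exact Submodule.starProjection_apply_mem _ _

theorem inner_eq_zero_of_mem_radialEigenspace (hd : 1 ≤ d) (hz : 0 < z) (hw : 0 < w) (hzw : z ≠ w)
    {u v : L2Ball d} (hu : u ∈ radialEigenspace d z) (hv : v ∈ radialEigenspace d w) :
    ⟪u, v⟫_ℂ = 0 := by
  obtain ⟨f, hf, huf⟩ := hu
  obtain ⟨g, hg, hvg⟩ := hv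
  obtain ⟨F, p, hF, hF1, hfF, -⟩ := hf.exists_isRadialProfile hd
  obtain ⟨G, q, hG, hG1, hgG, -⟩ := hg.exists_isRadialProfile hd
  rw [inner_eq_intervalIntegral hd huf hvg hfF hgG]
  have hne : z ^ 2 ≠ w ^ 2 := fun h => hzw ((sq_eq_sq₀ hz.le hw.le).1 h)
  have hFc : IsRadialProfile d z (fun r => (starRingEnd ℂ) (F r)) (fun r => (starRingEnd ℂ) (p r)) :=
    hF.map (Complex.conjCLE : ℂ →L[ℝ] ℂ)
  have := IsRadialProfile.integral_mul_eq_zero hd hFc (by simp [hF1]) hG hG1 hne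
  rw [this, smul_zero]

theorem eigenProj_eq_zero (hd : 1 ≤ d) (hz : 0 < z) (hw : 0 < w) (hzw : z ≠ w)
    {v : L2Ball d} (hv : v ∈ radialEigenspace d w) : eigenProj d z v = 0 := by
  refine (Submodule.starProjection_apply_eq_zero_iff _).2 ?_
  rw [topologicalClosure_radialEigenspace hd hz, Submodule.mem_orthogonal]
  exact fun u hu => inner_eq_zero_of_mem_radialEigenspace hd hz hw hzw hu hv

theorem exists_profile_of_mem_radialFrequencies (hd : 1 ≤ d) (hz : z ∈ radialFrequencies d) :
    ∃ F p : ℝ → ℝ, IsRadialProfile d z F p ∧ F 1 = 0 ∧ F 0 ≠ 0 := by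
  obtain ⟨hz0, hne⟩ := hz
  obtain ⟨v, ⟨f, hf, hv⟩, hv0⟩ := Submodule.exists_mem_ne_zero_of_ne_bot hne
  obtain ⟨F, p, hF, hF1, hfF, -⟩ := hf.exists_isRadialProfile hd
  by_contra hcon
  push Not at hcon
  have h1 := hcon _ _ hF.re (by simp [hF1])
  have h2 := hcon _ _ hF.im (by simp [hF1])
  have hF0 : F 0 = 0 := Complex.ext h1 h2
  have hf0 : f 0 = 0 := by rw [hfF 0 (by simp [unitBall]), norm_zero, hF0]
  refine hv0 (Lp.ext ?_)
  filter_upwards [hv, Lp.coeFn_zero ℂ 2 (ballMeasure d),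
    ae_restrict_mem (isOpen_unitBall d).measurableSet] with x h1 h2 hx
  rw [h1, h2, hf.eq_zero_of_apply_zero hd hz0 hf0 hx, Pi.zero_apply]

theorem one_lt_of_mem_radialFrequencies (hd : 1 ≤ d) (hz : z ∈ radialFrequencies d) : 1 < z := by
  obtain ⟨F, p, hF, hF1, hF0⟩ := exists_profile_of_mem_radialFrequencies hd hz
  exact hF.one_lt_frequency hd hz.1 hF1 hF0

/-- A lower bound for the gaps between radial frequencies. -/
noncomputable def frequencyGap (d : ℕ) : ℝ := Real.exp (-IsRadialProfile.liouvilleConst d)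

theorem frequencyGap_pos (d : ℕ) : 0 < frequencyGap d := Real.exp_pos _

theorem separatedOn_radialFrequencies (hd : 1 ≤ d) :
    SeparatedOn (frequencyGap d) id (radialFrequencies d) := by
  intro z hz w hw hzw
  obtain ⟨F, p, hF, hF1, hF0⟩ := exists_profile_of_mem_radialFrequencies hd hz
  obtain ⟨G, q, hG, hG1, hG0⟩ := exists_profile_of_mem_radialFrequencies hd hw
  exact IsRadialProfile.exp_le_sub hd hz.1 hzw hG hG1 hG0 hF hF1 hF0

/-- Write `x ^ α = x · x ^ (α - 1)`; the second factor is increasing and at least `1` because all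
frequencies exceed `1`. The gap is therefore uniform in `α`. -/
theorem separatedOn_rpow_radialFrequencies (hd : 1 ≤ d) {α : ℝ} (hα : 1 ≤ α) :
    SeparatedOn (frequencyGap d) (fun z => z ^ α) (radialFrequencies d) := by
  intro z hz w hw hzw
  have h1 := separatedOn_radialFrequencies hd z hz w hw hzw
  have hz1 := one_lt_of_mem_radialFrequencies hd hz
  have hw1 := one_lt_of_mem_radialFrequencies hd hw
  simp only [id] at h1
  have e : ∀ x : ℝ, 1 < x → x ^ α = x * x ^ (α - 1) := fun x hx => by
    rw [Real.rpow_sub_one (by positivity)]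
    field_simp
  have h2 : z ^ (α - 1) ≤ w ^ (α - 1) :=
    Real.rpow_le_rpow (by positivity) hzw.le (by linarith)
  have h3 : 1 ≤ z ^ (α - 1) := Real.one_le_rpow hz1.le (by linarith)
  simp only [e z hz1, e w hw1]
  nlinarith

/-- A frequency localized function is a finite sum of eigenfunctions, on which spectral multipliers
act diagonally. -/
theorem FrequencyLocalized.exists_finset (hd : 1 ≤ d) {N : ℝ} {u : L2Ball d}
    (hu : FrequencyLocalized N u) :
    ∃ (T : Finset ℝ) (v : ℝ → L2Ball d), (∀ z ∈ T, z ∈ radialFrequencies d ∧ z ∈ Icc N (2 * N)) ∧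
      (∀ z ∈ T, v z ∈ radialEigenspace d z) ∧ ∑ z ∈ T, ‖v z‖ ^ 2 = ‖u‖ ^ 2 ∧
      ∀ m : ℝ → ℂ, spectralMultiplier m u = ∑ z ∈ T, m z • v z := by
  have hfin := (separatedOn_radialFrequencies hd).finite_inter_Icc (frequencyGap_pos d) N (2 * N)
  set T := hfin.toFinset with hT
  have hmem : ∀ z, z ∈ T ↔ z ∈ radialFrequencies d ∧ z ∈ Icc N (2 * N) := fun z => by
    rw [hT, Set.Finite.mem_toFinset]
    rfl
  have hpos : ∀ z ∈ T, 0 < z := fun z hz => ((hmem z).1 hz).1.1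
  set v : ℝ → L2Ball d := fun z => eigenProj d z u with hv
  have hvm : ∀ z ∈ T, v z ∈ radialEigenspace d z := fun z hz => eigenProj_mem hd (hpos z hz) u
  have hsum : ∀ m : ℝ → ℂ, (∀ z ∈ radialFrequencies d, z ∉ T → m z • v z = 0) →
      spectralMultiplier m u = ∑ z ∈ T, m z • v z := by
    intro m hm
    rw [spectralMultiplier, tsum_subtype (radialFrequencies d) (fun z => m z • eigenProj d z u),
      tsum_eq_sum (s := T)]
    · refine Finset.sum_congr rfl fun z hz => ?_
      rw [indicator_of_mem ((hmem z).1 hz).1]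
    · intro z hz
      by_cases hzf : z ∈ radialFrequencies d
      · rw [indicator_of_mem hzf]
        exact hm z hzf hz
      · rw [indicator_of_notMem hzf]
  have hu' : u = ∑ z ∈ T, v z := by
    have h1 := hsum (indicator (Icc N (2 * N)) 1) (fun z hz hzT => by
      rw [indicator_of_notMem (fun h => hzT ((hmem z).2 ⟨hz, h⟩)), zero_smul])
    rw [FrequencyLocalized] at hu
    rw [hu] at h1
    rw [h1]
    refine Finset.sum_congr rfl fun z hz => ?_
    rw [indicator_of_mem ((hmem z).1 hz).2, Pi.one_apply, one_smul, hv]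
  -- Localization already exhibits `u` as a finite sum of eigenfunctions, so orthogonality kills
  -- every other component. Completeness of the eigenfunctions is not needed, and any `m` is
  -- allowed.
  have hout : ∀ z ∈ radialFrequencies d, z ∉ T → v z = 0 := by
    intro z hz hzT
    simp only [hv]
    rw [hu', map_sum]
    refine Finset.sum_eq_zero fun w hw => eigenProj_eq_zero hd hz.1 (hpos w hw) ?_ (hvm w hw)
    rintro rfl
    exact hzT hw
  refine ⟨T, v, fun z hz => (hmem z).1 hz, hvm, ?_, fun m => hsum m fun z hz hzT => ?_⟩
  · have h1 : ⟪u, u⟫_ℂ = ∑ z ∈ T, ⟪v z, v z⟫_ℂ := by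
      conv_lhs => rw [hu', sum_inner]
      refine Finset.sum_congr rfl fun z hz => ?_
      rw [inner_sum]
      refine Finset.sum_eq_single_of_mem z hz fun w hw hwz => ?_
      exact inner_eq_zero_of_mem_radialEigenspace hd (hpos z hz) (hpos w hw) hwz.symm
        (hvm z hz) (hvm w hw)
    simp only [inner_self_eq_norm_sq_to_K] at h1
    exact_mod_cast h1.symm
  · rw [hout z hz hzT, smul_zero]

end Eigenspaces

/-! ### Almost orthogonality in time. -/

theorem integrable_exp_neg_abs : Integrable (fun t : ℝ => Real.exp (-|t|)) := by
  rw [← integrableOn_univ, ← Iic_union_Ioi (a := (0 : ℝ))]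
  refine IntegrableOn.union ?_ ?_
  · refine (integrableOn_exp_Iic 0).congr_fun (fun t ht => ?_) measurableSet_Iic
    simp only [abs_of_nonpos (show t ≤ 0 from ht), neg_neg]
  · refine (integrableOn_exp_neg_Ioi 0).congr_fun (fun t ht => ?_) measurableSet_Ioi
    simp only [abs_of_pos (show 0 < t from ht)]

theorem integral_exp_neg_abs_mul_exp (ξ : ℝ) :
    ∫ t : ℝ, (Real.exp (-|t|) : ℂ) * Complex.exp (Complex.I * ((t * ξ : ℝ) : ℂ)) =
      ((2 / (1 + ξ ^ 2) : ℝ) : ℂ) := by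
  have hi : Integrable (fun t : ℝ =>
      (Real.exp (-|t|) : ℂ) * Complex.exp (Complex.I * ((t * ξ : ℝ) : ℂ))) := by
    refine integrable_exp_neg_abs.ofReal.mul_bdd (c := 1)
      (Continuous.aestronglyMeasurable (by fun_prop)) (Filter.Eventually.of_forall fun t => ?_)
    rw [mul_comm, Complex.norm_exp_ofReal_mul_I]
  rw [← intervalIntegral.integral_Iic_add_Ioi hi.integrableOn hi.integrableOn (b := 0)]
  have h1 : ∫ t in Iic (0 : ℝ), (Real.exp (-|t|) : ℂ) * Complex.exp (Complex.I * ((t * ξ : ℝ) : ℂ)) =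
      ∫ t in Iic (0 : ℝ), Complex.exp ((1 + Complex.I * ξ) * t) := by
    refine setIntegral_congr_fun measurableSet_Iic fun t ht => ?_
    simp only [abs_of_nonpos (show t ≤ 0 from ht), neg_neg, Complex.ofReal_exp]
    rw [← Complex.exp_add]
    push_cast
    ring_nf
  have h2 : ∫ t in Ioi (0 : ℝ), (Real.exp (-|t|) : ℂ) * Complex.exp (Complex.I * ((t * ξ : ℝ) : ℂ)) =
      ∫ t in Ioi (0 : ℝ), Complex.exp ((-1 + Complex.I * ξ) * t) := by
    refine setIntegral_congr_fun measurableSet_Ioi fun t ht => ?_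
    simp only [abs_of_pos (show 0 < t from ht), Complex.ofReal_exp]
    rw [← Complex.exp_add]
    push_cast
    ring_nf
  have n1 : (1 + Complex.I * ξ : ℂ) ≠ 0 := fun h => by simpa using congrArg Complex.re h
  have n2 : (-1 + Complex.I * ξ : ℂ) ≠ 0 := fun h => by simpa using congrArg Complex.re h
  have n3 : (1 + (ξ : ℂ) ^ 2) ≠ 0 := by
    have : (1 + ξ ^ 2 : ℝ) ≠ 0 := by positivity
    exact_mod_cast this
  rw [h1, h2, integral_exp_mul_complex_Iic (by simp), integral_exp_mul_complex_Ioi (by simp)]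
  simp only [Complex.ofReal_zero, mul_zero, Complex.exp_zero]
  push_cast
  field_simp
  ring_nf
  simp only [Complex.I_sq]
  ring

/-- Schur's test for a symmetric nonnegative kernel, from `2 a_i a_j ≤ a_i² + a_j²`. -/
theorem sum_mul_mul_le {ι : Type*} (T : Finset ι) (k : ι → ι → ℝ) (a : ι → ℝ) {B : ℝ}
    (hk : ∀ i j, 0 ≤ k i j) (hsymm : ∀ i j, k i j = k j i) (hB : ∀ i ∈ T, ∑ j ∈ T, k i j ≤ B) :
    ∑ i ∈ T, ∑ j ∈ T, k i j * (a i * a j) ≤ B * ∑ i ∈ T, a i ^ 2 := by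
  have h1 : ∑ i ∈ T, ∑ j ∈ T, k i j * (a i ^ 2) ≤ B * ∑ i ∈ T, a i ^ 2 := by
    rw [Finset.mul_sum]
    refine Finset.sum_le_sum fun i hi => ?_
    rw [← Finset.sum_mul]
    exact mul_le_mul_of_nonneg_right (hB i hi) (sq_nonneg _)
  have h2 : ∑ i ∈ T, ∑ j ∈ T, k i j * (a j ^ 2) = ∑ i ∈ T, ∑ j ∈ T, k i j * (a i ^ 2) := by
    rw [Finset.sum_comm]
    simp_rw [hsymm]
  have h3 : 2 * ∑ i ∈ T, ∑ j ∈ T, k i j * (a i * a j) ≤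
      ∑ i ∈ T, ∑ j ∈ T, k i j * (a i ^ 2) + ∑ i ∈ T, ∑ j ∈ T, k i j * (a j ^ 2) := by
    simp only [Finset.mul_sum, ← Finset.sum_add_distrib]
    refine Finset.sum_le_sum fun i _ => Finset.sum_le_sum fun j _ => ?_
    nlinarith [mul_nonneg (hk i j) (sq_nonneg (a i - a j))]
  linarith

section AlmostOrthogonality

variable {V ι : Type*} [NormedAddCommGroup V] [InnerProductSpace ℂ V]

theorem norm_exp_neg_I_mul (x : ℝ) : ‖Complex.exp (-Complex.I * (x : ℂ))‖ = 1 := by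
  rw [Complex.norm_exp]
  simp

theorem integral_exp_neg_abs_mul_norm_sq (T : Finset ι) (θ : ι → ℝ) (a : ι → V) :
    ((∫ t : ℝ, Real.exp (-|t|) *
        ‖∑ i ∈ T, Complex.exp (-Complex.I * ((t * θ i : ℝ) : ℂ)) • a i‖ ^ 2 : ℝ) : ℂ) =
      ∑ i ∈ T, ∑ j ∈ T, ((2 / (1 + (θ i - θ j) ^ 2) : ℝ) : ℂ) * ⟪a i, a j⟫_ℂ := by
  have hexp : ∀ t i j, (starRingEnd ℂ) (Complex.exp (-Complex.I * ((t * θ i : ℝ) : ℂ))) *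
      Complex.exp (-Complex.I * ((t * θ j : ℝ) : ℂ)) =
      Complex.exp (Complex.I * ((t * (θ i - θ j) : ℝ) : ℂ)) := by
    intro t i j
    rw [← Complex.exp_conj, ← Complex.exp_add]
    congr 1
    simp only [map_mul, map_neg, Complex.conj_I, Complex.conj_ofReal]
    push_cast
    ring
  have hpt : ∀ t : ℝ, ((Real.exp (-|t|) *
      ‖∑ i ∈ T, Complex.exp (-Complex.I * ((t * θ i : ℝ) : ℂ)) • a i‖ ^ 2 : ℝ) : ℂ) =
      ∑ i ∈ T, ∑ j ∈ T, (Real.exp (-|t|) : ℂ) *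
        Complex.exp (Complex.I * ((t * (θ i - θ j) : ℝ) : ℂ)) * ⟪a i, a j⟫_ℂ := by
    intro t
    rw [Complex.ofReal_mul, Complex.ofReal_pow]
    have h1 := inner_self_eq_norm_sq_to_K (𝕜 := ℂ)
      (∑ i ∈ T, Complex.exp (-Complex.I * ((t * θ i : ℝ) : ℂ)) • a i)
    have h2 : ((‖∑ i ∈ T, Complex.exp (-Complex.I * ((t * θ i : ℝ) : ℂ)) • a i‖ : ℝ) : ℂ) ^ 2 =
      _ := h1.symm
    rw [h2, sum_inner, Finset.mul_sum]
    refine Finset.sum_congr rfl fun i _ => ?_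
    rw [inner_sum, Finset.mul_sum]
    refine Finset.sum_congr rfl fun j _ => ?_
    rw [inner_smul_left, inner_smul_right, ← hexp]
    ring
  rw [← integral_complex_ofReal]
  simp_rw [hpt]
  have hi : ∀ i j, Integrable (fun t : ℝ => (Real.exp (-|t|) : ℂ) *
        Complex.exp (Complex.I * ((t * (θ i - θ j) : ℝ) : ℂ)) * ⟪a i, a j⟫_ℂ) := by
    intro i j
    refine (integrable_exp_neg_abs.ofReal.mul_bdd (c := 1)
      (Continuous.aestronglyMeasurable (by fun_prop))
      (Filter.Eventually.of_forall fun t => ?_)).mul_const _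
    rw [mul_comm, Complex.norm_exp_ofReal_mul_I]
  rw [integral_finsetSum _ fun i _ => integrable_finsetSum _ fun j _ => hi i j]
  refine Finset.sum_congr rfl fun i _ => ?_
  rw [integral_finsetSum _ fun j _ => hi i j]
  refine Finset.sum_congr rfl fun j _ => ?_
  rw [integral_mul_const, integral_exp_neg_abs_mul_exp]

/-- Almost orthogonality in time of oscillating exponentials. -/
theorem lintegral_norm_sum_exp_sq_le (T : Finset ι) (θ : ι → ℝ) (a : ι → V) {B : ℝ}
    (hB : ∀ i ∈ T, ∑ j ∈ T, 1 / (1 + (θ i - θ j) ^ 2) ≤ B) :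
    ∫⁻ t in Ioo (0 : ℝ) 1, ‖∑ i ∈ T, Complex.exp (-Complex.I * ((t * θ i : ℝ) : ℂ)) • a i‖ₑ ^ 2 ≤
      ENNReal.ofReal (2 * Real.exp 1 * B * ∑ i ∈ T, ‖a i‖ ^ 2) := by
  set Φ : ℝ → V := fun t => ∑ i ∈ T, Complex.exp (-Complex.I * ((t * θ i : ℝ) : ℂ)) • a i with hΦ
  have hΦc : Continuous Φ := by fun_prop
  have hΦb : ∀ t, ‖Φ t‖ ≤ ∑ i ∈ T, ‖a i‖ := fun t => by
    refine (norm_sum_le _ _).trans (Finset.sum_le_sum fun i _ => ?_)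
    rw [norm_smul, norm_exp_neg_I_mul, one_mul]
  have hint : Integrable (fun t : ℝ => Real.exp (-|t|) * ‖Φ t‖ ^ 2) := by
    refine integrable_exp_neg_abs.mul_bdd (c := (∑ i ∈ T, ‖a i‖) ^ 2)
      (Continuous.aestronglyMeasurable (by fun_prop)) (Filter.Eventually.of_forall fun t => ?_)
    rw [norm_pow, norm_norm]
    gcongr
    exact hΦb t
  have hmain : ∫ t : ℝ, Real.exp (-|t|) * ‖Φ t‖ ^ 2 ≤ 2 * B * ∑ i ∈ T, ‖a i‖ ^ 2 := by
    have h1 := integral_exp_neg_abs_mul_norm_sq T θ a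
    have h2 : ∫ t : ℝ, Real.exp (-|t|) * ‖Φ t‖ ^ 2 ≤
        ‖((∫ t : ℝ, Real.exp (-|t|) * ‖Φ t‖ ^ 2 : ℝ) : ℂ)‖ := by
      rw [Complex.norm_real]
      exact le_abs_self _
    refine h2.trans ?_
    rw [h1]
    refine (norm_sum_le _ _).trans ?_
    have h3 : ∑ i ∈ T, ‖∑ j ∈ T, ((2 / (1 + (θ i - θ j) ^ 2) : ℝ) : ℂ) * ⟪a i, a j⟫_ℂ‖ ≤
        ∑ i ∈ T, ∑ j ∈ T, 2 / (1 + (θ i - θ j) ^ 2) * (‖a i‖ * ‖a j‖) := by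
      refine Finset.sum_le_sum fun i _ => (norm_sum_le _ _).trans
        (Finset.sum_le_sum fun j _ => ?_)
      rw [norm_mul, Complex.norm_real, Real.norm_of_nonneg (by positivity)]
      gcongr
      exact norm_inner_le_norm _ _
    refine h3.trans (sum_mul_mul_le T _ (fun i => ‖a i‖) (fun i j => by positivity)
      (fun i j => by rw [← neg_sub, neg_sq]) fun i hi => ?_)
    calc _ = 2 * ∑ j ∈ T, 1 / (1 + (θ i - θ j) ^ 2) := by
          rw [Finset.mul_sum]
          exact Finset.sum_congr rfl fun j _ => by ring
      _ ≤ 2 * B := by gcongr; exact hB i hi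
  -- On `(0, 1)` the weight satisfies `e · e ^ (-|t|) ≥ 1`, which accounts for the factor `Real.exp
  -- 1`.
  calc ∫⁻ t in Ioo (0 : ℝ) 1, ‖Φ t‖ₑ ^ 2
      ≤ ∫⁻ t in Ioo (0 : ℝ) 1, ENNReal.ofReal (Real.exp 1 * (Real.exp (-|t|) * ‖Φ t‖ ^ 2)) := by
        refine setLIntegral_mono' measurableSet_Ioo fun t ht => ?_
        rw [← ofReal_norm, ← ENNReal.ofReal_pow (norm_nonneg _)]
        refine ENNReal.ofReal_le_ofReal ?_
        rw [← mul_assoc, ← Real.exp_add, abs_of_pos ht.1]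
        exact le_mul_of_one_le_left (sq_nonneg _) (Real.one_le_exp (by linarith [ht.2]))
    _ ≤ ∫⁻ t, ENNReal.ofReal (Real.exp 1 * (Real.exp (-|t|) * ‖Φ t‖ ^ 2)) :=
        setLIntegral_le_lintegral _ _
    _ = ENNReal.ofReal (∫ t, Real.exp 1 * (Real.exp (-|t|) * ‖Φ t‖ ^ 2)) :=
        (ofReal_integral_eq_lintegral_ofReal (hint.const_mul _)
          (Filter.Eventually.of_forall fun t => by positivity)).symm
    _ ≤ _ := by
        rw [integral_const_mul]
        refine ENNReal.ofReal_le_ofReal ?_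
        calc _ ≤ Real.exp 1 * (2 * B * ∑ i ∈ T, ‖a i‖ ^ 2) := by gcongr
          _ = _ := by ring

end AlmostOrthogonality

/-- The constant bounding the sum of `1 / (1 + (y - s)²)` over a `c`-separated set of `s`. -/
noncomputable def separatedSumConst (c : ℝ) : ℝ :=
  (3 + 2 / c ^ 2) * ∑' k : ℤ, 1 / (1 + (k : ℝ) ^ 2)

theorem summable_one_div_one_add_int_sq : Summable fun k : ℤ => 1 / (1 + (k : ℝ) ^ 2) := by
  refine Summable.of_norm_bounded_eventually
    (g := fun k : ℤ => 1 / (k : ℝ) ^ 2) (Real.summable_one_div_int_pow.2 one_lt_two) ?_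
  filter_upwards [(Set.finite_singleton (0 : ℤ)).compl_mem_cofinite] with k hk
  have hk0 : (k : ℝ) ≠ 0 := by exact_mod_cast hk
  rw [Real.norm_of_nonneg (by positivity)]
  gcongr
  linarith

theorem separatedSumConst_pos {c : ℝ} (hc : 0 < c) : 0 < separatedSumConst c := by
  have : 0 < ∑' k : ℤ, 1 / (1 + (k : ℝ) ^ 2) :=
    summable_one_div_one_add_int_sq.tsum_pos (fun k => by positivity) 0 (by simp)
  unfold separatedSumConst
  positivity

theorem SeparatedOn.sum_le {c : ℝ} {φ : ℝ → ℝ} {T : Finset ℝ} (h : SeparatedOn c φ T)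
    (hc : 0 < c) (y : ℝ) : ∑ s ∈ T, 1 / (1 + (y - φ s) ^ 2) ≤ separatedSumConst c := by
  set k : ℝ → ℤ := fun s => ⌊(φ s - y) / c⌋ with hk
  have hinj : InjOn k T := h.injOn_floor hc y
  -- With `x = (φ s - y) / c` and `k = ⌊x⌋`, one has `1 + k² ≤ 3 + 2 x² ≤ (3 + 2 / c²) (1 + c² x²)`;
  -- since `k` is injective, the sum is dominated by one over the integers.
  have h1 : ∀ s ∈ T, 1 / (1 + (y - φ s) ^ 2) ≤ (3 + 2 / c ^ 2) * (1 / (1 + (k s : ℝ) ^ 2)) := by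
    intro s _
    rw [mul_one_div, div_le_div_iff₀ (by positivity) (by positivity), one_mul]
    set x := (φ s - y) / c with hx
    have e : (y - φ s) ^ 2 = c ^ 2 * x ^ 2 := by rw [hx]; field_simp; ring
    have f1 := Int.floor_le x
    have f2 := Int.lt_floor_add_one x
    have hks : k s = ⌊x⌋ := rfl
    rw [e, hks]
    have g1 : (⌊x⌋ : ℝ) ^ 2 ≤ 2 * x ^ 2 + 2 := by
      have : (⌊x⌋ : ℝ) = x - (x - ⌊x⌋) := by ring
      nlinarith [sq_nonneg (x + (x - ⌊x⌋))]
    have e2 : (3 + 2 / c ^ 2) * (1 + c ^ 2 * x ^ 2) =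
      3 + 2 * x ^ 2 + (3 * c ^ 2 * x ^ 2 + 2 / c ^ 2) := by field_simp; ring
    rw [e2]
    have : 0 ≤ 3 * c ^ 2 * x ^ 2 + 2 / c ^ 2 := by positivity
    linarith
  refine (Finset.sum_le_sum h1).trans ?_
  rw [← Finset.mul_sum, separatedSumConst]
  gcongr
  rw [← Finset.sum_image (f := fun k : ℤ => 1 / (1 + (k : ℝ) ^ 2)) hinj]
  exact summable_one_div_one_add_int_sq.sum_le_tsum _ fun _ _ => by positivity

/-! ### Linearity of weak gradients. -/

instance isFiniteMeasure_ballMeasure (d : ℕ) : IsFiniteMeasure (ballMeasure d) :=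
  ⟨by rw [ballMeasure, Measure.restrict_apply_univ]; exact measure_ball_lt_top⟩

namespace HasWeakGradient

variable {d : ℕ} {u u' : L2Ball d} {G G' : Lp (EuclideanSpace ℂ (Fin d)) 2 (ballMeasure d)}

theorem integrable_mul {ψ : EuclideanSpace ℝ (Fin d) → ℝ} (hψ : Continuous ψ)
    (hψc : HasCompactSupport ψ) {k : EuclideanSpace ℝ (Fin d) → ℂ}
    (hk : Integrable k (ballMeasure d)) :
    Integrable (fun x => ((ψ x : ℝ) : ℂ) * k x) (ballMeasure d) := by
  obtain ⟨C, hC⟩ := hψc.exists_bound_of_continuous hψ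
  refine hk.bdd_mul (c := C) (Continuous.aestronglyMeasurable (by fun_prop))
    (Filter.Eventually.of_forall fun x => ?_)
  rw [Complex.norm_real]
  exact hC x

theorem integrable_coe (u : L2Ball d) : Integrable u (ballMeasure d) :=
  (Lp.memLp u).integrable one_le_two

theorem integrable_apply (G : Lp (EuclideanSpace ℂ (Fin d)) 2 (ballMeasure d)) (i : Fin d) :
    Integrable (fun x => G x i) (ballMeasure d) :=
  (EuclideanSpace.proj (𝕜 := ℂ) i).integrable_comp ((Lp.memLp G).integrable one_le_two)

theorem iff_integral_ballMeasure : HasWeakGradient u G ↔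
    ∀ φ : EuclideanSpace ℝ (Fin d) → ℝ, ContDiff ℝ ∞ φ → HasCompactSupport φ →
      tsupport φ ⊆ unitBall d → ∀ i : Fin d,
        ∫ x, ((fderiv ℝ φ x (EuclideanSpace.single i 1) : ℝ) : ℂ) * u x ∂ballMeasure d =
          -∫ x, ((φ x : ℝ) : ℂ) * G x i ∂ballMeasure d := Iff.rfl

theorem zero : HasWeakGradient (0 : L2Ball d) 0 := by
  rw [iff_integral_ballMeasure]
  intro φ _ _ _ i
  have h1 : ∫ x, ((fderiv ℝ φ x (EuclideanSpace.single i 1) : ℝ) : ℂ) *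
      (0 : L2Ball d) x ∂ballMeasure d = 0 := by
    refine integral_eq_zero_of_ae ?_
    filter_upwards [Lp.coeFn_zero ℂ 2 (ballMeasure d)] with x hx
    rw [hx]
    simp
  have h2 : ∫ x, ((φ x : ℝ) : ℂ) *
      (0 : Lp (EuclideanSpace ℂ (Fin d)) 2 (ballMeasure d)) x i ∂ballMeasure d = 0 := by
    refine integral_eq_zero_of_ae ?_
    filter_upwards [Lp.coeFn_zero (EuclideanSpace ℂ (Fin d)) 2 (ballMeasure d)] with x hx
    rw [hx]
    simp
  rw [h1, h2, neg_zero]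

theorem add_const_smul (hu : HasWeakGradient u G) (c : ℂ) (hu' : HasWeakGradient u' G') :
    HasWeakGradient (c • u' + u) (c • G' + G) := by
  rw [iff_integral_ballMeasure] at *
  intro φ hφ hφc hφs i
  have hd : Continuous fun x => fderiv ℝ φ x (EuclideanSpace.single i 1) :=
    (hφ.continuous_fderiv (by simp)).clm_apply continuous_const
  have hdc : HasCompactSupport fun x => fderiv ℝ φ x (EuclideanSpace.single i 1) :=
    hφc.mono' (subset_closure.trans (tsupport_fderiv_apply_subset ℝ _))
  have h1 : ∫ x, ((fderiv ℝ φ x (EuclideanSpace.single i 1) : ℝ) : ℂ) *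
      (c • u' + u : L2Ball d) x ∂ballMeasure d =
      c * (∫ x, ((fderiv ℝ φ x (EuclideanSpace.single i 1) : ℝ) : ℂ) * u' x ∂ballMeasure d) +
        ∫ x, ((fderiv ℝ φ x (EuclideanSpace.single i 1) : ℝ) : ℂ) * u x ∂ballMeasure d := by
    rw [← integral_const_mul, ← integral_add
      ((integrable_mul hd hdc (integrable_coe u')).const_mul c)
      (integrable_mul hd hdc (integrable_coe u))]
    refine integral_congr_ae ?_
    filter_upwards [Lp.coeFn_add (c • u') u, Lp.coeFn_smul c u'] with x h1 h2
    rw [h1, Pi.add_apply, h2, Pi.smul_apply, smul_eq_mul]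
    ring
  have h2 : ∫ x, ((φ x : ℝ) : ℂ) *
      (c • G' + G : Lp (EuclideanSpace ℂ (Fin d)) 2 (ballMeasure d)) x i ∂ballMeasure d =
      c * (∫ x, ((φ x : ℝ) : ℂ) * G' x i ∂ballMeasure d) +
        ∫ x, ((φ x : ℝ) : ℂ) * G x i ∂ballMeasure d := by
    rw [← integral_const_mul, ← integral_add
      ((integrable_mul hφ.continuous hφc (integrable_apply G' i)).const_mul c)
      (integrable_mul hφ.continuous hφc (integrable_apply G i))]
    refine integral_congr_ae ?_
    filter_upwards [Lp.coeFn_add (c • G') G, Lp.coeFn_smul c G'] with x h1 h2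
    rw [h1, Pi.add_apply, h2, Pi.smul_apply, PiLp.add_apply, PiLp.smul_apply, smul_eq_mul]
    ring
  rw [h1, h2, hu φ hφ hφc hφs i, hu' φ hφ hφc hφs i]
  ring

theorem sum_const_smul {ι : Type*} (T : Finset ι) (m : ι → ℂ) (v : ι → L2Ball d)
    (g : ι → Lp (EuclideanSpace ℂ (Fin d)) 2 (ballMeasure d))
    (h : ∀ i ∈ T, HasWeakGradient (v i) (g i)) :
    HasWeakGradient (∑ i ∈ T, m i • v i) (∑ i ∈ T, m i • g i) := by
  classical
  induction T using Finset.induction_on with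
  | empty => simpa using zero
  | insert a s ha ih =>
    rw [Finset.sum_insert ha, Finset.sum_insert ha]
    exact (ih fun i hi => h i (Finset.mem_insert_of_mem hi)).add_const_smul (m a)
      (h a (Finset.mem_insert_self a s))

theorem of_isRadialDirichletSolution {z : ℝ} {f : EuclideanSpace ℝ (Fin d) → ℂ}
    (hf : IsRadialDirichletSolution d z f) (hu : u =ᵐ[ballMeasure d] f)
    (hG : G =ᵐ[ballMeasure d] complexGradient f) : HasWeakGradient u G := by
  intro φ hφ hφc hφs i
  have h1 : ∫ x in unitBall d, ((fderiv ℝ φ x (EuclideanSpace.single i 1) : ℝ) : ℂ) * u x =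
      ∫ x in unitBall d, ((fderiv ℝ φ x (EuclideanSpace.single i 1) : ℝ) : ℂ) * f x := by
    refine integral_congr_ae ?_
    filter_upwards [hu] with x hx
    rw [hx]
  have h2 : ∫ x in unitBall d, ((φ x : ℝ) : ℂ) * G x i =
      ∫ x in unitBall d, ((φ x : ℝ) : ℂ) * complexGradient f x i := by
    refine integral_congr_ae ?_
    filter_upwards [hG] with x hx
    rw [hx]
  rw [h1, h2]
  exact hf.integral_fderiv_mul hφ hφc hφs i

end HasWeakGradient

theorem MeasureTheory.Lp.coeFn_sum_const_smul {α ι V : Type*} [MeasurableSpace α] {μ : Measure α}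
    [NormedAddCommGroup V] [NormedSpace ℂ V] (T : Finset ι) (m : ι → ℂ) (v : ι → Lp V 2 μ)
    (f : ι → α → V) (h : ∀ i ∈ T, v i =ᵐ[μ] f i) :
    (∑ i ∈ T, m i • v i : Lp V 2 μ) =ᵐ[μ] fun x => ∑ i ∈ T, m i • f i x := by
  classical
  induction T using Finset.induction_on with
  | empty =>
    filter_upwards [Lp.coeFn_zero V 2 μ] with x hx
    simpa using hx
  | insert a s ha ih =>
    rw [Finset.sum_insert ha]
    filter_upwards [ih fun i hi => h i (Finset.mem_insert_of_mem hi), h a (Finset.mem_insert_self a s),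
      Lp.coeFn_add (m a • v a) (∑ i ∈ s, m i • v i), Lp.coeFn_smul (m a) (v a)] with x h1 h2 h3 h4
    rw [h3, Pi.add_apply, h4, Pi.smul_apply, h1, h2, Finset.sum_insert ha]

/-! ### The spatial weight `|x| ^ (s - d)`. -/

section Weight

variable {d : ℕ}

theorem integrableOn_norm_rpow (hd : 1 ≤ d) {s : ℝ} (hs : 0 < s) :
    IntegrableOn (fun x : EuclideanSpace ℝ (Fin d) => ‖x‖ ^ (s - d)) (unitBall d) := by
  have : Nonempty (Fin d) := ⟨⟨0, hd⟩⟩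
  have h := (integrableOn_fun_norm_addHaar (E := EuclideanSpace ℝ (Fin d)) volume
    (f := fun r : ℝ => r ^ (s - d)) (r := 1)).2
  refine h ?_
  rw [finrank_euclideanSpace_fin]
  have h1 : IntegrableOn (fun r : ℝ => r ^ (s - 1)) (Ioo 0 1) :=
    (intervalIntegral.integrableOn_Ioo_rpow_iff one_pos).2 (by linarith)
  refine h1.congr_fun (fun r hr => ?_) measurableSet_Ioo
  simp only [smul_eq_mul]
  rw [← Real.rpow_natCast, ← Real.rpow_add hr.1, Nat.cast_sub hd]
  congr 1
  push_cast
  ring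

/-- The integral of `|x| ^ (s - d)` over the unit ball. -/
noncomputable def weightIntegral (d : ℕ) (s : ℝ) : ℝ :=
  ∫ x in unitBall d, ‖x‖ ^ (s - d)

theorem weightIntegral_nonneg (d : ℕ) (s : ℝ) : 0 ≤ weightIntegral d s :=
  integral_nonneg fun x => Real.rpow_nonneg (norm_nonneg x) _

namespace IsRadialDirichletSolution

open IsRadialProfile (boundConst boundConst_pos)

variable {z : ℝ} {f : EuclideanSpace ℝ (Fin d) → ℂ} {v : L2Ball d}

/-- Interpolates `‖f‖² ≤ K z ^ (d - 1)`, used for `r z ≤ 1`, with `‖f‖² ≤ K r ^ (-(d - 1))`, used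
for `r z ≥ 1`. Spending `s` powers of `z` makes the singularity `r ^ (-d)` integrable. The far case
needs `d - 2 + s ≥ 0`. -/
theorem norm_sq_div_pow_le (hd : 2 ≤ d) (hz : 0 < z) (hf : IsRadialDirichletSolution d z f)
    (hv : v =ᵐ[ballMeasure d] f) {s : ℝ} (hs : 0 ≤ s) (hs1 : s ≤ 1)
    {x : EuclideanSpace ℝ (Fin d)} (hx : x ∈ unitBall d) (hx0 : x ≠ 0) :
    ‖f x‖ ^ 2 / ‖x‖ ^ (d - 1) ≤
      boundConst d / sphereArea d * ‖v‖ ^ 2 * z ^ ((d : ℝ) - 2 + s) * ‖x‖ ^ (s - d) := by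
  have hd1 : 1 ≤ d := by omega
  have hr : 0 < ‖x‖ := norm_pos_iff.2 hx0
  set r := ‖x‖ with hrdef
  set K := boundConst d / sphereArea d * ‖v‖ ^ 2 with hK
  have hK0 : 0 ≤ K := mul_nonneg (div_nonneg (boundConst_pos d).le (sphereArea_pos hd1).le)
    (sq_nonneg _)
  have hd2 : (2 : ℝ) ≤ d := by exact_mod_cast hd
  have hcast : ((d - 1 : ℕ) : ℝ) = (d : ℝ) - 1 := by rw [Nat.cast_sub hd1]; simp
  have e1 : r ^ (s - d) = r ^ (s - 1) / r ^ (d - 1) := by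
    rw [← Real.rpow_natCast r (d - 1), ← Real.rpow_sub hr, hcast]
    congr 1
    ring
  rw [e1, ← mul_div_assoc]
  gcongr
  rcases le_total (r * z) 1 with h | h
  · have h1 := hf.norm_sq_le hd1 hz hv hx
    have e2 : z ^ (d - 1) = z ^ ((d : ℝ) - 2 + s) * z ^ (1 - s) := by
      rw [← Real.rpow_natCast, ← Real.rpow_add hz, hcast]
      congr 1
      ring
    have e3 : z ^ (1 - s) ≤ r ^ (s - 1) := by
      have h2 : z ≤ r⁻¹ := by rw [← one_div, le_div_iff₀ hr]; linarith
      calc z ^ (1 - s) ≤ (r⁻¹) ^ (1 - s) := Real.rpow_le_rpow hz.le h2 (by linarith)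
        _ = r ^ (s - 1) := by rw [Real.inv_rpow hr.le, ← Real.rpow_neg hr.le, neg_sub]
    calc ‖f x‖ ^ 2 ≤ K * z ^ (d - 1) := h1.trans_eq (by rw [hK]; ring)
      _ = K * z ^ ((d : ℝ) - 2 + s) * z ^ (1 - s) := by rw [e2]; ring
      _ ≤ _ := by gcongr
  · have h1 := hf.pow_mul_norm_sq_le hd1 hz hv hx hx0
    have hrp : 0 < r ^ (d - 1) := pow_pos hr _
    have e2 : (1 : ℝ) ≤ r ^ (d - 1) * (z ^ ((d : ℝ) - 2 + s) * r ^ (s - 1)) := by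
      have h2 : (1 : ℝ) ≤ (r * z) ^ ((d : ℝ) - 2 + s) := Real.one_le_rpow h (by linarith)
      refine h2.trans_eq ?_
      rw [Real.mul_rpow hr.le hz.le, ← Real.rpow_natCast r (d - 1), hcast,
        show (d : ℝ) - 2 + s = ((d : ℝ) - 1) + (s - 1) by ring, Real.rpow_add hr]
      ring
    refine le_of_mul_le_mul_left ?_ hrp
    calc r ^ (d - 1) * ‖f x‖ ^ 2 ≤ K * 1 := by rw [mul_one]; exact h1
      _ ≤ K * (r ^ (d - 1) * (z ^ ((d : ℝ) - 2 + s) * r ^ (s - 1))) := by gcongr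
      _ = _ := by ring

theorem aestronglyMeasurable (hf : IsRadialDirichletSolution d z f) :
    AEStronglyMeasurable f (ballMeasure d) :=
  hf.contDiffOn.continuousOn.aestronglyMeasurable (isOpen_unitBall d).measurableSet

end IsRadialDirichletSolution

end Weight

/-! ### The bilinear estimate. -/

/-- Almost orthogonality in time for products of two oscillating sums. -/
theorem lintegral_norm_sum_smul_sum_sq_le {V : Type*} [NormedAddCommGroup V]
    [InnerProductSpace ℂ V] {c : ℝ} (hc : 0 < c) {φ : ℝ → ℝ} {T₁ T₂ : Finset ℝ}
    (hT₁ : SeparatedOn c φ T₁) (a : ℝ → V) (b : ℝ → ℂ) :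
    ∫⁻ t in Ioo (0 : ℝ) 1,
      ‖(∑ w ∈ T₂, Complex.exp (-Complex.I * ((t * φ w : ℝ) : ℂ)) • b w) •
        ∑ z ∈ T₁, Complex.exp (-Complex.I * ((t * φ z : ℝ) : ℂ)) • a z‖ₑ ^ 2 ≤
      ENNReal.ofReal (2 * Real.exp 1 * (T₂.card * separatedSumConst c) *
        ((∑ w ∈ T₂, ‖b w‖ ^ 2) * ∑ z ∈ T₁, ‖a z‖ ^ 2)) := by
  have h := lintegral_norm_sum_exp_sq_le (T₂ ×ˢ T₁) (fun i => φ i.1 + φ i.2)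
    (fun i => b i.1 • a i.2) (B := T₂.card * separatedSumConst c) ?_
  · refine le_trans (le_of_eq ?_) (h.trans_eq ?_)
    · refine lintegral_congr fun t => ?_
      rw [Finset.sum_smul, Finset.sum_product]
      refine congrArg (fun y : V => ‖y‖ₑ ^ 2) (Finset.sum_congr rfl fun w _ => ?_)
      rw [Finset.smul_sum]
      refine Finset.sum_congr rfl fun z _ => ?_
      rw [smul_smul, smul_smul, smul_eq_mul]
      congr 1
      rw [mul_add, Complex.ofReal_add, mul_add, Complex.exp_add]
      ring
    · congr 2
      rw [Finset.sum_mul_sum, Finset.sum_product]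
      refine Finset.sum_congr rfl fun w _ => Finset.sum_congr rfl fun z _ => ?_
      rw [norm_smul, mul_pow]
  -- Schur row sum over pairs: for each of the `#T₂` values of `w`, the phases `φ z` are separated,
  -- so the sum over `z` is bounded whatever the shift. Only this factor `#T₂` is lost.
  · intro i _
    rw [Finset.sum_product, ← nsmul_eq_mul]
    refine Finset.sum_le_card_nsmul _ _ _ fun w _ => ?_
    refine le_trans (le_of_eq ?_) (hT₁.sum_le hc (φ i.1 + φ i.2 - φ w))
    refine Finset.sum_congr rfl fun z _ => ?_
    ring_nf

section Bilinear

open IsRadialProfile (boundConst boundConst_pos)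

variable {d : ℕ} {V : Type*} [NormedAddCommGroup V] [InnerProductSpace ℂ V]

/-- The bilinear estimate for finite sums, with the high frequency factor abstracted to functions
`a z` decaying like `|x| ^ (-(d - 1) / 2)`. -/
theorem lintegral_lintegral_norm_smul_sq_le (hd : 2 ≤ d) {s : ℝ} (hs : 0 < s) (hs1 : s ≤ 1)
    {c : ℝ} (hc : 0 < c) {φ : ℝ → ℝ} {T₁ T₂ : Finset ℝ} (hT₁ : SeparatedOn c φ T₁)
    (hT₂ : ∀ w ∈ T₂, 0 < w) {a : ℝ → EuclideanSpace ℝ (Fin d) → V} {A : ℝ → ℝ}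
    (ham : ∀ z ∈ T₁, AEStronglyMeasurable (a z) (ballMeasure d))
    (ha : ∀ z ∈ T₁, ∀ x ∈ unitBall d, x ≠ 0 → ‖x‖ ^ (d - 1) * ‖a z x‖ ^ 2 ≤ A z)
    {f : ℝ → EuclideanSpace ℝ (Fin d) → ℂ} {v : ℝ → L2Ball d}
    (hf : ∀ w ∈ T₂, IsRadialDirichletSolution d w (f w))
    (hv : ∀ w ∈ T₂, v w =ᵐ[ballMeasure d] f w) :
    ∫⁻ t in Ioo (0 : ℝ) 1, ∫⁻ x in unitBall d,
      ‖(∑ w ∈ T₂, Complex.exp (-Complex.I * ((t * φ w : ℝ) : ℂ)) • f w x) •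
        ∑ z ∈ T₁, Complex.exp (-Complex.I * ((t * φ z : ℝ) : ℂ)) • a z x‖ₑ ^ 2 ≤
      ENNReal.ofReal (2 * Real.exp 1 * (T₂.card * separatedSumConst c) *
        ((∑ w ∈ T₂, boundConst d / sphereArea d * ‖v w‖ ^ 2 * w ^ ((d : ℝ) - 2 + s)) *
          ∑ z ∈ T₁, A z) * weightIntegral d s) := by
  have hd1 : 1 ≤ d := by omega
  set B := 2 * Real.exp 1 * (T₂.card * separatedSumConst c) with hB
  have hB0 : 0 ≤ B := by
    have := separatedSumConst_pos hc
    positivity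
  set D := ∑ w ∈ T₂, boundConst d / sphereArea d * ‖v w‖ ^ 2 * w ^ ((d : ℝ) - 2 + s) with hD
  set A' := ∑ z ∈ T₁, A z with hA'
  have hmeas : AEMeasurable (Function.uncurry fun (t : ℝ) (x : EuclideanSpace ℝ (Fin d)) =>
      ‖(∑ w ∈ T₂, Complex.exp (-Complex.I * ((t * φ w : ℝ) : ℂ)) • f w x) •
        ∑ z ∈ T₁, Complex.exp (-Complex.I * ((t * φ z : ℝ) : ℂ)) • a z x‖ₑ ^ 2)
      ((volume.restrict (Ioo (0 : ℝ) 1)).prod (ballMeasure d)) := by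
    have he : ∀ w, AEStronglyMeasurable
        (fun y : ℝ × EuclideanSpace ℝ (Fin d) => Complex.exp (-Complex.I * ((y.1 * φ w : ℝ) : ℂ)))
        ((volume.restrict (Ioo (0 : ℝ) 1)).prod (ballMeasure d)) := fun w =>
      Continuous.aestronglyMeasurable (by fun_prop)
    refine (AEStronglyMeasurable.enorm ?_).pow_const 2
    refine AEStronglyMeasurable.fun_smul
      (Finset.aestronglyMeasurable_fun_sum _ fun w hw => (he w).fun_smul ?_)
      (Finset.aestronglyMeasurable_fun_sum _ fun z hz => (he z).fun_smul ?_)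
    · exact (hf w hw).aestronglyMeasurable.comp_snd
    · exact (ham z hz).comp_snd
  have hsw := lintegral_lintegral_swap hmeas
  refine (hsw.trans_le ?_)
  have hpt : ∀ᵐ x ∂ballMeasure d, ∫⁻ t in Ioo (0 : ℝ) 1,
      ‖(∑ w ∈ T₂, Complex.exp (-Complex.I * ((t * φ w : ℝ) : ℂ)) • f w x) •
        ∑ z ∈ T₁, Complex.exp (-Complex.I * ((t * φ z : ℝ) : ℂ)) • a z x‖ₑ ^ 2 ≤
      ENNReal.ofReal (B * (D * A') * ‖x‖ ^ (s - d)) := by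
    have : Nonempty (Fin d) := ⟨⟨0, hd1⟩⟩
    have hne : ∀ᵐ x ∂ballMeasure d, x ≠ 0 :=
      ae_restrict_of_ae (compl_mem_ae_iff.2 (measure_singleton (0 : EuclideanSpace ℝ (Fin d))))
    filter_upwards [hne, ae_restrict_mem (isOpen_unitBall d).measurableSet] with x hx0 hx
    refine (lintegral_norm_sum_smul_sum_sq_le hc hT₁ (fun z => a z x) (fun w => f w x)).trans
      (ENNReal.ofReal_le_ofReal ?_)
    have hr : 0 < ‖x‖ ^ (d - 1) := pow_pos (norm_pos_iff.2 hx0) _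
    have h1 : (∑ w ∈ T₂, ‖f w x‖ ^ 2) / ‖x‖ ^ (d - 1) ≤ D * ‖x‖ ^ (s - d) := by
      rw [Finset.sum_div, hD, Finset.sum_mul]
      exact Finset.sum_le_sum fun w hw =>
        (hf w hw).norm_sq_div_pow_le hd (hT₂ w hw) (hv w hw) hs.le hs1 hx hx0
    have h2 : ‖x‖ ^ (d - 1) * ∑ z ∈ T₁, ‖a z x‖ ^ 2 ≤ A' := by
      rw [Finset.mul_sum]
      exact Finset.sum_le_sum fun z hz => ha z hz x hx hx0
    have h3 : 0 ≤ ∑ w ∈ T₂, ‖f w x‖ ^ 2 := Finset.sum_nonneg fun w _ => sq_nonneg _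
    have h4 : 0 ≤ ∑ z ∈ T₁, ‖a z x‖ ^ 2 := Finset.sum_nonneg fun z _ => sq_nonneg _
    have h5 : 0 ≤ (∑ w ∈ T₂, ‖f w x‖ ^ 2) / ‖x‖ ^ (d - 1) := by positivity
    -- The power `‖x‖ ^ (d - 1)` is moved from one factor to the other, so that the decay of the `a
    -- z` is paid for by the interpolated bound on the `f w`.
    calc _ = B * (((∑ w ∈ T₂, ‖f w x‖ ^ 2) / ‖x‖ ^ (d - 1)) *
          (‖x‖ ^ (d - 1) * ∑ z ∈ T₁, ‖a z x‖ ^ 2)) := by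
          rw [hB]
          field_simp
      _ ≤ B * ((D * ‖x‖ ^ (s - d)) * A') := by
          gcongr
          exact h5.trans h1
      _ = _ := by ring
  have hDA : 0 ≤ D * A' := by
    refine mul_nonneg (Finset.sum_nonneg fun w hw => ?_) (Finset.sum_nonneg fun z hz => ?_)
    · exact mul_nonneg (mul_nonneg (div_nonneg (boundConst_pos d).le (sphereArea_pos hd1).le)
        (sq_nonneg _)) (Real.rpow_nonneg (hT₂ w hw).le _)
    -- Nonnegativity of `A z` is read off from `ha` at an arbitrary nonzero point of the ball.
    · have hx : (2⁻¹ : ℝ) • EuclideanSpace.single (⟨0, hd1⟩ : Fin d) (1 : ℝ) ∈ unitBall d := by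
        simp only [unitBall, mem_ball_zero_iff, norm_smul]
        norm_num
      refine le_trans ?_ (ha z hz _ hx (by simp))
      positivity
  refine (lintegral_mono_ae hpt).trans_eq ?_
  have hi := (integrableOn_norm_rpow hd1 hs).const_mul (B * (D * A'))
  have h6 := ofReal_integral_eq_lintegral_ofReal hi (Filter.Eventually.of_forall fun x =>
    mul_nonneg (mul_nonneg hB0 hDA) (Real.rpow_nonneg (norm_nonneg x) (s - d)))
  rw [ballMeasure, ← h6, integral_const_mul, weightIntegral]

/-- The square of the constant in the bilinear estimate. -/
noncomputable def bilinearConst (d : ℕ) (ε : ℝ) : ℝ :=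
  2 * Real.exp 1 * ((1 / frequencyGap d + 2) * separatedSumConst (frequencyGap d)) *
    (boundConst d / sphereArea d) ^ 2 * 2 ^ ((d : ℝ) - 2 + 2 * ε) *
      weightIntegral d (min (2 * ε) 1)

theorem bilinearConst_nonneg (hd : 1 ≤ d) (ε : ℝ) : 0 ≤ bilinearConst d ε := by
  have h1 := separatedSumConst_pos (frequencyGap_pos d)
  have h2 := frequencyGap_pos d
  have h3 := sphereArea_pos hd
  have h4 := weightIntegral_nonneg d (min (2 * ε) 1)
  unfold bilinearConst
  positivity

theorem spacetimeL2Norm_smul_le (hd : 2 ≤ d) {ε : ℝ} (hε : 0 < ε) {N : ℝ} (hN : 0 < N)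
    {α : ℝ} (hα : 1 ≤ α) {T₁ T₂ : Finset ℝ} (hT₁ : ∀ z ∈ T₁, z ∈ radialFrequencies d)
    (hT₂ : ∀ w ∈ T₂, w ∈ radialFrequencies d ∧ w ∈ Icc N (2 * N))
    {a : ℝ → EuclideanSpace ℝ (Fin d) → V} {v₁ v₂ : ℝ → L2Ball d} {L : ℝ} (hL : 0 ≤ L)
    (ham : ∀ z ∈ T₁, AEStronglyMeasurable (a z) (ballMeasure d))
    (ha : ∀ z ∈ T₁, ∀ x ∈ unitBall d, x ≠ 0 →
      ‖x‖ ^ (d - 1) * ‖a z x‖ ^ 2 ≤ boundConst d / sphereArea d * L ^ 2 * ‖v₁ z‖ ^ 2)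
    {f : ℝ → EuclideanSpace ℝ (Fin d) → ℂ}
    (hf : ∀ w ∈ T₂, IsRadialDirichletSolution d w (f w))
    (hv : ∀ w ∈ T₂, v₂ w =ᵐ[ballMeasure d] f w) {U₁ U₂ : ℝ} (hU₁ : 0 ≤ U₁) (hU₂ : 0 ≤ U₂)
    (h₁ : ∑ z ∈ T₁, ‖v₁ z‖ ^ 2 = U₁ ^ 2) (h₂ : ∑ w ∈ T₂, ‖v₂ w‖ ^ 2 = U₂ ^ 2)
    {F : ℝ → EuclideanSpace ℝ (Fin d) → V}
    (hF : ∀ t, F t =ᵐ[ballMeasure d] fun x =>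
      (∑ w ∈ T₂, Complex.exp (-Complex.I * ((t * w ^ α : ℝ) : ℂ)) • f w x) •
        ∑ z ∈ T₁, Complex.exp (-Complex.I * ((t * z ^ α : ℝ) : ℂ)) • a z x) :
    spacetimeL2Norm F ≤ ENNReal.ofReal
      (Real.sqrt (bilinearConst d ε) * L * N ^ (((d : ℝ) - 1) / 2 + ε) * U₁ * U₂) := by
  have hd1 : 1 ≤ d := by omega
  have hd2 : (2 : ℝ) ≤ d := by exact_mod_cast hd
  -- The interpolation needs `s ≤ 1`; since `w > 1`, the power `w ^ s` is at most `w ^ (2ε)`.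
  set s := min (2 * ε) 1 with hs
  have hs0 : 0 < s := lt_min (by positivity) one_pos
  set c := frequencyGap d with hc
  have hc0 : 0 < c := frequencyGap_pos d
  set K := boundConst d / sphereArea d with hK
  have hK0 : 0 ≤ K := div_nonneg (boundConst_pos d).le (sphereArea_pos hd1).le
  have hpos₂ : ∀ w ∈ T₂, 1 < w := fun w hw => one_lt_of_mem_radialFrequencies hd1 (hT₂ w hw).1
  have hsep : SeparatedOn c (fun z => z ^ α) T₁ := fun x hx y hy hxy =>
    separatedOn_rpow_radialFrequencies hd1 hα x (hT₁ x hx) y (hT₁ y hy) hxy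
  have key := lintegral_lintegral_norm_smul_sq_le hd hs0 (min_le_right _ _) hc0 hsep
    (fun w hw => zero_lt_one.trans (hpos₂ w hw)) ham ha hf hv
  -- If `T₂` is nonempty, then `1 < w ≤ 2 N`, so the `+ 1` in the counting bound is absorbed by `2
  -- N`.
  have hcard : (T₂.card : ℝ) ≤ (1 / c + 2) * N := by
    rcases T₂.eq_empty_or_nonempty with h | ⟨w, hw⟩
    · rw [h, Finset.card_empty, Nat.cast_zero]
      positivity
    · have hsep₂ : SeparatedOn c id T₂ := fun x hx y hy hxy =>
        separatedOn_radialFrequencies hd1 x (hT₂ x hx).1 y (hT₂ y hy).1 hxy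
      have h3 := hsep₂.card_le hc0 (a := N) (b := 2 * N) (by linarith) fun x hx => (hT₂ x hx).2
      have h4 := hpos₂ w hw
      have h5 := (hT₂ w hw).2.2
      calc (T₂.card : ℝ) ≤ (2 * N - N) / c + 1 := h3
        _ = 1 / c * N + 1 := by ring
        _ ≤ _ := by linarith
  have hD : ∑ w ∈ T₂, K * ‖v₂ w‖ ^ 2 * w ^ ((d : ℝ) - 2 + s) ≤
      K * (2 * N) ^ ((d : ℝ) - 2 + 2 * ε) * U₂ ^ 2 := by
    rw [← h₂, Finset.mul_sum]
    refine Finset.sum_le_sum fun w hw => ?_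
    have h3 : w ^ ((d : ℝ) - 2 + s) ≤ (2 * N) ^ ((d : ℝ) - 2 + 2 * ε) :=
      calc w ^ ((d : ℝ) - 2 + s) ≤ w ^ ((d : ℝ) - 2 + 2 * ε) :=
            Real.rpow_le_rpow_of_exponent_le (hpos₂ w hw).le (by linarith [min_le_left (2 * ε) 1])
        _ ≤ _ := Real.rpow_le_rpow (zero_lt_one.trans (hpos₂ w hw)).le (hT₂ w hw).2.2
            (by linarith)
    calc _ ≤ K * ‖v₂ w‖ ^ 2 * (2 * N) ^ ((d : ℝ) - 2 + 2 * ε) := by gcongr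
      _ = _ := by ring
  have hA : ∑ z ∈ T₁, K * L ^ 2 * ‖v₁ z‖ ^ 2 = K * L ^ 2 * U₁ ^ 2 := by
    rw [← h₁, Finset.mul_sum]
  have hbd : spacetimeL2Norm F ≤ (ENNReal.ofReal
      ((Real.sqrt (bilinearConst d ε) * L * N ^ (((d : ℝ) - 1) / 2 + ε) * U₁ * U₂) ^ 2)) ^
        (1 / 2 : ℝ) := by
    unfold spacetimeL2Norm
    refine ENNReal.rpow_le_rpow ?_ (by norm_num)
    have hcongr : ∀ t, ∫⁻ x in unitBall d, ‖F t x‖ₑ ^ 2 = ∫⁻ x in unitBall d,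
        ‖(∑ w ∈ T₂, Complex.exp (-Complex.I * ((t * w ^ α : ℝ) : ℂ)) • f w x) •
          ∑ z ∈ T₁, Complex.exp (-Complex.I * ((t * z ^ α : ℝ) : ℂ)) • a z x‖ₑ ^ 2 := by
      intro t
      refine lintegral_congr_ae ?_
      filter_upwards [hF t] with x hx
      rw [hx]
    simp_rw [hcongr]
    refine key.trans (ENNReal.ofReal_le_ofReal ?_)
    rw [hA]
    have hNe : (N ^ (((d : ℝ) - 1) / 2 + ε)) ^ 2 = N * N ^ ((d : ℝ) - 2 + 2 * ε) := by
      rw [← Real.rpow_natCast, ← Real.rpow_mul hN.le]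
      nth_rewrite 2 [← Real.rpow_one N]
      rw [← Real.rpow_add hN]
      congr 1
      push_cast
      ring
    have hsc := separatedSumConst_pos hc0
    have hw := weightIntegral_nonneg d s
    have hD0 : 0 ≤ ∑ w ∈ T₂, K * ‖v₂ w‖ ^ 2 * w ^ ((d : ℝ) - 2 + s) :=
      Finset.sum_nonneg fun w hw => mul_nonneg (mul_nonneg hK0 (sq_nonneg _))
        (Real.rpow_nonneg (zero_lt_one.trans (hpos₂ w hw)).le _)
    calc _ ≤ 2 * Real.exp 1 * (((1 / c + 2) * N) * separatedSumConst c) *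
          ((K * (2 * N) ^ ((d : ℝ) - 2 + 2 * ε) * U₂ ^ 2) * (K * L ^ 2 * U₁ ^ 2)) *
            weightIntegral d s := by
          gcongr
      _ = bilinearConst d ε * L ^ 2 * (N * N ^ ((d : ℝ) - 2 + 2 * ε)) * U₁ ^ 2 * U₂ ^ 2 := by
          rw [Real.mul_rpow two_pos.le hN.le, bilinearConst]
          ring
      _ = _ := by
          rw [mul_pow, mul_pow, mul_pow, mul_pow, Real.sq_sqrt (bilinearConst_nonneg hd1 ε), hNe]
  refine hbd.trans_eq ?_
  have hnn : 0 ≤ Real.sqrt (bilinearConst d ε) * L * N ^ (((d : ℝ) - 1) / 2 + ε) * U₁ * U₂ := by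
    positivity
  rw [ENNReal.ofReal_rpow_of_nonneg (sq_nonneg _) (by norm_num), ← Real.sqrt_eq_rpow,
    Real.sqrt_sq hnn]

end Bilinear

/-! ### The theorem. -/

theorem lemma5p2 (d : ℕ) (hd : 2 ≤ d) (ε : ℝ) (hε : 0 < ε) :
    ∃ C : ℝ, 0 < C ∧
      ∀ σ : ℝ, 1 / 2 ≤ σ → σ ≤ 1 →
      ∀ N₁ N₂ : ℝ, 0 < N₁ → 0 < N₂ →
      ∀ u₁ u₂ : L2Ball d, IsRadialL2 u₁ → IsRadialL2 u₂ →
        FrequencyLocalized N₁ u₁ → FrequencyLocalized N₂ u₂ →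
        (N₂ ≤ N₁ →
          spacetimeL2Norm (fun t x => schrodingerFlow σ t u₁ x * schrodingerFlow σ t u₂ x) ≤
            ENNReal.ofReal (C * N₂ ^ (((d : ℝ) - 1) / 2 + ε) * ‖u₁‖ * ‖u₂‖)) ∧
        ∃ G : ℝ → Lp (EuclideanSpace ℂ (Fin d)) 2 (ballMeasure d),
          (∀ t, HasWeakGradient (schrodingerFlow σ t u₁) (G t)) ∧
          spacetimeL2Norm (fun t x => schrodingerFlow σ t u₂ x • G t x) ≤
            ENNReal.ofReal (C * N₁ * N₂ ^ (((d : ℝ) - 1) / 2 + ε) * ‖u₁‖ * ‖u₂‖) := by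
  have hd1 : 1 ≤ d := by omega
  set R := Real.sqrt (bilinearConst d ε) with hR
  have hR0 : 0 ≤ R := Real.sqrt_nonneg _
  -- The factor `2` comes from `z ≤ 2 N₁` in the gradient bound; the `+ 1` ensures positivity, as
  -- `R` is only known to be nonnegative.
  refine ⟨2 * R + 1, by positivity, ?_⟩
  intro σ hσ _ N₁ N₂ hN₁ hN₂ u₁ u₂ _ _ hu₁ hu₂
  obtain ⟨T₁, v₁, hT₁, hm₁, hs₁, hS₁⟩ := hu₁.exists_finset hd1
  obtain ⟨T₂, v₂, hT₂, hm₂, hs₂, hS₂⟩ := hu₂.exists_finset hd1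
  have hm₁' : ∀ z ∈ T₁, ∃ f, IsRadialDirichletSolution d z f ∧ v₁ z =ᵐ[ballMeasure d] f := hm₁
  have hm₂' : ∀ z ∈ T₂, ∃ f, IsRadialDirichletSolution d z f ∧ v₂ z =ᵐ[ballMeasure d] f := hm₂
  choose! f₁ hf₁ hv₁ using hm₁'
  choose! f₂ hf₂ hv₂ using hm₂'
  have hg : ∀ z ∈ T₁, ∃ g : Lp (EuclideanSpace ℂ (Fin d)) 2 (ballMeasure d),
      g =ᵐ[ballMeasure d] complexGradient (f₁ z) := fun z hz =>
    ⟨((hf₁ z hz).memLp_complexGradient hd1).toLp, MemLp.coeFn_toLp _⟩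
  choose! g hg using hg
  have hα : 1 ≤ 2 * σ := by linarith
  have hflow₁ : ∀ t, schrodingerFlow σ t u₁ =ᵐ[ballMeasure d] fun x =>
      ∑ z ∈ T₁, Complex.exp (-Complex.I * ((t * z ^ (2 * σ) : ℝ) : ℂ)) • f₁ z x := fun t => by
    rw [schrodingerFlow, hS₁]
    exact Lp.coeFn_sum_const_smul T₁ _ v₁ f₁ hv₁
  have hflow₂ : ∀ t, schrodingerFlow σ t u₂ =ᵐ[ballMeasure d] fun x =>
      ∑ z ∈ T₂, Complex.exp (-Complex.I * ((t * z ^ (2 * σ) : ℝ) : ℂ)) • f₂ z x := fun t => by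
    rw [schrodingerFlow, hS₂]
    exact Lp.coeFn_sum_const_smul T₂ _ v₂ f₂ hv₂
  refine ⟨fun _ => ?_, fun t => ∑ z ∈ T₁,
    Complex.exp (-Complex.I * ((t * z ^ (2 * σ) : ℝ) : ℂ)) • g z, fun t => ?_, ?_⟩
  · refine (spacetimeL2Norm_smul_le hd hε hN₂ hα (fun z hz => (hT₁ z hz).1) hT₂ zero_le_one
      (a := f₁) (v₁ := v₁) (fun z hz => (hf₁ z hz).aestronglyMeasurable) (fun z hz x hx hx0 => ?_)
      hf₂ hv₂ (norm_nonneg u₁) (norm_nonneg u₂) hs₁ hs₂ (fun t => ?_)).trans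
      (ENNReal.ofReal_le_ofReal ?_)
    · rw [one_pow, mul_one]
      exact (hf₁ z hz).pow_mul_norm_sq_le hd1 (hT₁ z hz).1.1 (hv₁ z hz) hx hx0
    · filter_upwards [hflow₁ t, hflow₂ t] with x h1 h2
      rw [h1, h2, smul_eq_mul, mul_comm]
    · gcongr
      linarith
  · rw [schrodingerFlow, hS₁]
    exact HasWeakGradient.sum_const_smul T₁ _ v₁ g fun z hz =>
      HasWeakGradient.of_isRadialDirichletSolution (hf₁ z hz) (hv₁ z hz) (hg z hz)
  · refine (spacetimeL2Norm_smul_le hd hε hN₂ hα (fun z hz => (hT₁ z hz).1) hT₂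
      (show 0 ≤ 2 * N₁ by linarith) (a := fun z => complexGradient (f₁ z)) (v₁ := v₁)
      (fun z hz => ((hf₁ z hz).memLp_complexGradient hd1).aestronglyMeasurable)
      (fun z hz x hx hx0 => ?_) hf₂ hv₂ (norm_nonneg u₁) (norm_nonneg u₂) hs₁ hs₂
      (fun t => ?_)).trans (ENNReal.ofReal_le_ofReal ?_)
    · refine ((hf₁ z hz).pow_mul_norm_complexGradient_sq_le hd1 (hT₁ z hz).1.1 (hv₁ z hz) hx
        hx0).trans ?_
      have h1 := (hT₁ z hz).2.2
      have h2 := (hT₁ z hz).1.1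
      have h3 : 0 ≤ IsRadialProfile.boundConst d / sphereArea d :=
        div_nonneg (IsRadialProfile.boundConst_pos d).le (sphereArea_pos hd1).le
      gcongr
    · filter_upwards [hflow₂ t, Lp.coeFn_sum_const_smul T₁
        (fun z => Complex.exp (-Complex.I * ((t * z ^ (2 * σ) : ℝ) : ℂ))) g _ hg] with x h1 h2
      rw [h1, h2]
    · rw [show R * (2 * N₁) = 2 * R * N₁ by ring]
      gcongr
      linarith
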